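/- **Setting.** There are $n$ voters, $r$ candidates, $t$ authorities and a security parameter $s$, with $n,r,s\ge 1$. Any set of voters and any set of authorities may be dishonest; at least one authority is honest. The dishonest participants form one collusion with arbitrary, possibly randomized, computationally unbounded behaviour: each of its messages may depend on everything it has seen so far, namely all broadcasts and all private messages to its members. It is fixed in advance who is dishonest. In a *simultaneous broadcast* no input depends on the other inputs, and the protocol aborts if a participant refuses to take part; in other rounds the collusion may speak last. Put $m=2n+1$. A value $v\in\mathbb Z_m$ is *shared* when the authorities hold uniformly random values $v_a\in\mathbb Z_m$ subject to $\sum_a v_a=v$; a value is opened, and a combination of shared values is revealed, by a simultaneous broadcast of the shares. Every candidate has $n$ bins. A *ballot* for candidate $c$ in bin $o$ is a list of $rn$ shared values, one per bin, which are $0$ except for a $1$ in bin $o$ of $c$. RANDOM draws a uniform element of $\{0,\dots,\ell-1\}$: every authority inputs such an element into a simultaneous broadcast, and the result is their sum modulo $\ell$. **The protocol VOTE-AUTHORITIES-ROBUST.** Voter $i$ has a vote $x_i$ among the $r$ candidates. 1. Each voter $i$ makes $s$ sets of $2s$ ballots for $x_i$, with one independent uniformly random bin per set. For each ballot the voter draws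 a uniform shift modulo $r$ of the candidate and a uniform shift modulo $n$ of the bin, applies them to the ballot, and shares the result among the authorities. 2. RANDOM selects half of the ballots in each set. These are opened, and the vote of the voter is revoked if one of them is not a ballot. The voters broadcast the shifts of their remaining ballots, and the authorities undo them on their shares. 3. For each voter and candidate $c$, consider for each remaining ballot the sum of its bins for $c$. For each $k$ modulo $s$, the $2s$ sums of the sets $k$ and $k+1$ are tested for equality: RANDOM chooses $s$ partitions of them into two halves $P,Q$, and the sum over $P$ minus the sum over $Q$ is revealed for each partition. If one of these differences is not $0$, the vote is revoked. 4. Every authority broadcasts which votes are revoked; if the authorities disagree, the protocol aborts. 5. RANDOM selects a remaining ballot from each set of each voter whose vote is not revoked. For each of the $s$ set indices, the bin-wise sum of the selected ballots is revealed. The protocol aborts unless all bins have values in $\{0,\dots,n\}$ that add up (as integers) to the number of votes that are not revoked. The tally of a candidate is the sum of the values of the candidate's bins. The protocol aborts if the $s$ tallies are not all the same. Every authority broadcasts the tally, and the vote fails (abort) if they disagree. If the protocol does not abort, it *succeeds*, and its output is the tally and the set $R$ of voters whose votes are revoked. The output is *consistent with the honest votes* if there is an assignment $y$ of a candidate to each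 voter with $y_i=x_i$ for every honest voter $i$, such that the tally of each candidate $c$ is $\#\{i\notin R : y_i=c\}$. **Theorem 6 (Protocol 3 correctness).** (a) There is an absolute constant $q\in(0,1)$ such that for all $n\ge 2$, $r,s\ge 1$ and $t$, all sets of dishonest voters and dishonest authorities with at least one honest authority, all votes, and any behaviour of the collusion, the probability that the protocol succeeds and its output is not consistent with the honest votes is at most $q^s$. (b) Dishonest authorities can revoke votes, including honest ones: for $n,r,s\ge1$, if there is at least one dishonest and at least one honest authority, then for every set $R$ of voters and all votes of the dishonest voters the collusion has a behaviour such that, whatever the votes of the honest voters are, with probability $1$ the protocol succeeds, exactly the votes of the voters in $R$ are revoked, and the tally counts exactly the votes of all other voters. (c) This power belongs to dishonest authorities alone: for $n,r,s\ge1$, if there is at least one authority and all authorities are honest, then, whatever the dishonest voters do, the probability that the protocol succeeds and the vote of some given honest voter is revoked is $0$. -/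

import Mathlib

/-! Voting with `n` voters, `r` candidates, `t` authorities and security parameter `s`.
Voters are `Fin n`, candidates `Fin r`, authorities `Fin t`; each candidate has `n` bins, and
secrets are shared additively modulo `2 * n + 1`. In this file `B` is always the set of dishonest
voters and `A` the set of dishonest authorities; together they form a single collusion. -/

namespace RobustVote

open Finset

/-- A list of `r * n` residues modulo `2 * n + 1`: the secrets of a VOTING-BIN-SET,
or one authority's share of it. -/
abbrev Bins (n r : ℕ) : Type := Fin r → Fin n → ZMod (2 * n + 1)

/-- The secrets of the BALLOT for candidate `c` in bin `o`. -/
def ballot {n r : ℕ} (c : Fin r) (o : Fin n) : Bins n r :=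
  fun c' o' => if c' = c ∧ o' = o then 1 else 0

/-- The given secrets are those of some BALLOT. -/
def IsBallot {n r : ℕ} (v : Bins n r) : Prop := ∃ c o, v = ballot c o

/-- MAKE-ADS, applied to every bin: all authorities but the last one get uniform values `u`, the
last one gets the difference to the secret. (The entry of `u` at the last authority is unused.) -/
def makeADS {n r t : ℕ} (v : Bins n r) (u : Fin t → Bins n r) (a : Fin t) : Bins n r :=
  if a.val + 1 = t then v - ∑ b with b.val + 1 < t, u b else u a

/-- Undo the shift of the candidates by `d.1` (mod `r`) and of the bins by `d.2` (mod `n`). -/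
def decrypt {n r : ℕ} (d : Fin r × Fin n) (v : Bins n r) : Bins n r :=
  fun c o => v (c + d.1) (o + d.2)

/-- For a total of `N` ballots: every bin has a secret in `{0, …, n}`, and these integers add up
to `N`. -/
def SumConsistent {n r : ℕ} (N : ℕ) (Y : Bins n r) : Prop :=
  (∀ c o, (Y c o).val ≤ n) ∧ ∑ c, ∑ o, (Y c o).val = N

/-- The tally of each candidate: the sum of the integers in the candidate's bins. -/
def tallyOf {n r : ℕ} (Y : Bins n r) : Fin r → ℕ := fun c => ∑ o, (Y c o).val

/-! ### Random choices -/

/-- The subsets of size `s` of `2 * s` objects. -/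
abbrev Half (s : ℕ) : Type := {P : Finset (Fin (2 * s)) // P.card = s}

instance (s : ℕ) : Nonempty (Half s) := by
  obtain ⟨P, -, hP⟩ := Finset.exists_subset_card_eq
    (s := (Finset.univ : Finset (Fin (2 * s)))) (n := s) (by simp; omega)
  exact ⟨⟨P, hP⟩⟩

/-- The elements of the chosen half, in increasing order. -/
def Half.inside {s : ℕ} (P : Half s) : Fin s → Fin (2 * s) := P.1.orderEmbOfFin P.2

/-- The elements outside the chosen half, in increasing order. -/
def Half.outside {s : ℕ} (P : Half s) : Fin s → Fin (2 * s) :=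
  P.1ᶜ.orderEmbOfFin (by rw [Finset.card_compl, P.2, Fintype.card_fin]; omega)

/-- For each voter and each of the voter's `s` sets, which half of the `2 * s` ballots is opened. -/
abbrev OpenChoice (n s : ℕ) : Type := Fin n → Fin s → Half s

/-- The `s` partitions used in one call of ADS-EQUALITY. -/
abbrev EqChoice (s : ℕ) : Type := Fin s → Half s

/-- For each voter and each set, which of the `s` remaining ballots is tallied. -/
abbrev PickChoice (n s : ℕ) : Type := Fin n → Fin s → Fin s

/-- An element of `{0, …, ℓ - 1}`, where `ℓ` is the number of elements of `C`. -/
abbrev Coin (C : Type) [Fintype C] : Type := Fin (Fintype.card C)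

/-- The outcome of RANDOM: the inputs of the authorities are added modulo `ℓ`, and the result is
the number of an element of `C` in a fixed enumeration. -/
noncomputable def randomValue {C : Type} [Fintype C] [Nonempty C] {t : ℕ}
    (a : Fin t → Coin C) : C :=
  (Fintype.equivFin C).symm
    ⟨(∑ i, (a i : ℕ)) % Fintype.card C, Nat.mod_lt _ Fintype.card_pos⟩

/-- All random choices that the participants make when they follow the protocol.
(The entries of dishonest participants are not used.) -/
@[ext] structure Tape (n r t s : ℕ) where
  /-- the voter's bin in each set -/
  bin : Fin n → Fin s → Fin n
  /-- the voter's two shift values for each ballot of each set -/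
  shift : Fin n → Fin s → Fin (2 * s) → Fin r × Fin n
  /-- the voter's random values in MAKE-ADS -/
  mask : Fin n → Fin s → Fin (2 * s) → Fin t → Bins n r
  /-- an authority's input to RANDOM for the opening -/
  openCoin : Fin t → Coin (OpenChoice n s)
  /-- an authority's inputs to RANDOM for the calls of ADS-EQUALITY -/
  eqCoin : Fin n → Fin r → Fin s → Fin t → Coin (EqChoice s)
  /-- an authority's input to RANDOM for the choice of the tallied ballots -/
  pickCoin : Fin t → Coin (PickChoice n s)

set_option synthInstance.maxSize 1000 in
set_option synthInstance.maxHeartbeats 400000 in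
noncomputable instance (n r t s : ℕ) : Fintype (Tape n r t s) := by
  classical
  exact Fintype.ofInjective
    (fun ω : Tape n r t s =>
      (ω.bin, ω.shift, ω.mask, ω.openCoin, ω.eqCoin, ω.pickCoin))
    (fun ω ω' h => by
      simp only [Prod.mk.injEq] at h
      obtain ⟨h1, h2, h3, h4, h5, h6⟩ := h
      exact Tape.ext h1 h2 h3 h4 h5 h6)

instance (n r t s : ℕ) [NeZero n] [NeZero r] [NeZero s] : Nonempty (Tape n r t s) :=
  ⟨⟨fun _ _ => 0, fun _ _ _ => (0, 0), fun _ _ _ _ => 0, fun _ => ⟨0, Fintype.card_pos⟩,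
    fun _ _ _ _ => ⟨0, Fintype.card_pos⟩, fun _ => ⟨0, Fintype.card_pos⟩⟩⟩

/-- The share that authority `a` gets of ballot `j` in set `k` of the honest voter `i` with vote
`c`: the voter shifts the BALLOT for `c` in the bin of the set, and shares the result. -/
def honestShare {n r t s : ℕ} (ω : Tape n r t s) (c : Fin r) (i : Fin n) (a : Fin t)
    (k : Fin s) (j : Fin (2 * s)) : Bins n r :=
  makeADS (ballot (c + (ω.shift i k j).1) (ω.bin i k + (ω.shift i k j).2)) (ω.mask i k j) a

/-! ### What the collusion sees, and what it can do -/

/-- A message of type `M` from each honest authority. -/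
abbrev Honest {t : ℕ} (A : Finset (Fin t)) (M : Type) : Type := ∀ a, a ∉ A → M

/-- The messages of the honest authorities among all messages. -/
def honestPart {t : ℕ} (A : Finset (Fin t)) {M : Type} (f : Fin t → M) : Honest A M :=
  fun a _ => f a

/-- The simultaneous broadcast. The honest authorities input `honest a`. A dishonest authority
inputs `adv a`, where `none` is a refusal to participate, which makes the broadcast abort. That
the inputs are simultaneous is expressed by what the strategy of the collusion may depend on. -/
def simBroadcast {t : ℕ} (A : Finset (Fin t)) {M : Type} (honest : Fin t → M)
    (adv : Fin t → Option M) : Option (Fin t → M) :=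
  if ∀ a ∈ A, (adv a).isSome then
    some fun a => if a ∈ A then (adv a).getD (honest a) else honest a
  else none

section Views

variable (n r t s : ℕ) (B : Finset (Fin n)) (A : Finset (Fin t))

/-- The shares that honest voters send to dishonest authorities. -/
abbrev DealView : Type :=
  ∀ i, i ∉ B → ∀ a, a ∈ A → Fin s → Fin (2 * s) → Bins n r

/-- The view of the collusion when the shift values are broadcast. -/
structure ShiftView where
  dealt : DealView n r t s B A
  /-- the honest inputs to RANDOM for the opening -/
  openCoin : Honest A (Coin (OpenChoice n s))
  /-- the honest shares of the opened ballots of each set of each voter -/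
  opened : Honest A (Fin n → Fin s → Fin s → Bins n r)
  /-- the shift values that honest voters broadcast for the remaining ballots of each set -/
  shift : ∀ i, i ∉ B → Fin s → Fin s → Fin r × Fin n

/-- What the honest authorities broadcast in one call of ADS-EQUALITY. -/
structure EqRecord where
  coin : Honest A (Coin (EqChoice s))
  value : Honest A (Fin s → ZMod (2 * n + 1))

/-- The view of the collusion after the ballots have been tested for equality: the last component
lists the calls of ADS-EQUALITY, the latest one first. -/
abbrev TestView : Type := ShiftView n r t s B A × List (EqRecord n t s A)

/-- A deterministic strategy of the collusion of the voters in `B` and the authorities in `A`: its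
messages in each round, as functions of what it has seen before. It is rushing: except in
simultaneous broadcasts, it sees the honest messages of a round before it sends its own.
It also hears all broadcasts among the authorities.
Values for honest participants are ignored. A message that a dishonest voter fails to send is
read as some fixed value. -/
structure Strategy where
  /-- shares that dishonest voters send to authorities -/
  deal : DealView n r t s B A → Fin n → Fin t → Fin s → Fin (2 * s) → Bins n r
  /-- inputs to RANDOM for the opening -/
  openCoin : DealView n r t s B A → Fin t → Option (Coin (OpenChoice n s))
  /-- purported shares of the opened ballots -/
  openShare : DealView n r t s B A → Honest A (Coin (OpenChoice n s)) →
    Fin t → Option (Fin n → Fin s → Fin s → Bins n r)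
  /-- shift values that dishonest voters broadcast for their remaining ballots -/
  shift : ShiftView n r t s B A → Fin n → Fin s → Fin s → Fin r × Fin n
  /-- inputs to RANDOM in the next call of ADS-EQUALITY -/
  eqCoin : TestView n r t s B A → Fin t → Option (Coin (EqChoice s))
  /-- purported shares of the `s` differences in the next call of ADS-EQUALITY -/
  eqShare : TestView n r t s B A → Honest A (Coin (EqChoice s)) →
    Fin t → Option (Fin s → ZMod (2 * n + 1))
  /-- bits that say which votes are revoked -/
  bit : TestView n r t s B A → Fin t → Fin n → Bool
  /-- inputs to RANDOM for the choice of the tallied ballots -/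
  pickCoin : TestView n r t s B A → Fin t → Option (Coin (PickChoice n s))
  /-- purported shares of the `s` sums of ballots -/
  tallyShare : TestView n r t s B A → Honest A (Coin (PickChoice n s)) →
    Fin t → Option (Fin s → Bins n r)
  /-- results of the vote made public -/
  publish : TestView n r t s B A → Honest A (Coin (PickChoice n s)) →
    Honest A (Fin s → Bins n r) → Fin t → Fin r → ℕ

end Views

/-! ### The protocol -/

/-- The public output of a run that succeeds. -/
structure Outcome (n r : ℕ) where
  tally : Fin r → ℕ
  /-- the voters whose vote was revoked -/
  revoked : Finset (Fin n)

section Run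

variable {n r t s : ℕ} [NeZero n] [NeZero r] [NeZero s]

/-- One authority's share of the ADS that are compared for a voter, a candidate `c` and a set `k`,
given its decrypted shares of the voter's remaining ballots: the sums of the bins for `c` of
the ballots in set `k` and in set `k + 1` (mod `s`). -/
def eqInput (v : Fin s → Fin s → Bins n r) (c : Fin r) (k : Fin s) :
    Fin (2 * s) → ZMod (2 * n + 1) :=
  fun j => if h : (j : ℕ) < s then ∑ o, v k ⟨j, h⟩ c o
    else ∑ o, v (k + 1) ⟨j - s, by omega⟩ c o

/-- One authority's shares of the sum over `P` minus the sum over the complement of `P`, for each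
of the `s` partitions. -/
def eqDifference (X : Fin (2 * s) → ZMod (2 * n + 1)) (P : EqChoice s) :
    Fin s → ZMod (2 * n + 1) :=
  fun l => ∑ j ∈ (P l).1, X j - ∑ j ∈ (P l).1ᶜ, X j

open Classical in
/-- One call of ADS-EQUALITY, for voter `q.1`, candidate `q.2.1` and set `q.2.2`; `share` holds the
decrypted shares of the remaining ballots. The state consists of the record of the previous
calls and of the set of the voters for which some call has returned *unequal*. -/
noncomputable def eqCall {B : Finset (Fin n)} {A : Finset (Fin t)} (adv : Strategy n r t s B A)
    (ω : Tape n r t s) (view : ShiftView n r t s B A)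
    (share : Fin n → Fin t → Fin s → Fin s → Bins n r)
    (st : List (EqRecord n t s A) × Finset (Fin n)) (q : Fin n × Fin r × Fin s) :
    Option (List (EqRecord n t s A) × Finset (Fin n)) := do
  let honestCoin := ω.eqCoin q.1 q.2.1 q.2.2
  let coins ← simBroadcast A honestCoin (adv.eqCoin (view, st.1))
  let P : EqChoice s := randomValue coins
  let honestValue := fun a => eqDifference (eqInput (share q.1 a) q.2.1 q.2.2) P
  let Y ← simBroadcast A honestValue (adv.eqShare (view, st.1) (honestPart A honestCoin))
  return (⟨honestPart A honestCoin, honestPart A honestValue⟩ :: st.1,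
    if ∀ l, ∑ a, Y a l = 0 then st.2 else insert q.1 st.2)

open Classical in
/-- A run of VOTE-AUTHORITIES-ROBUST with votes `x`, against the strategy `adv` of the collusion,
with random choices `ω` of the honest participants; `none` means that the protocol aborts. -/
noncomputable def run {B : Finset (Fin n)} {A : Finset (Fin t)} (x : Fin n → Fin r)
    (adv : Strategy n r t s B A) (ω : Tape n r t s) : Option (Outcome n r) := do
  -- The voters distribute their encrypted ballots.
  let dealt : DealView n r t s B A := fun i _ a _ => honestShare ω (x i) i a
  let share : Fin n → Fin t → Fin s → Fin (2 * s) → Bins n r := fun i a =>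
    if i ∈ B then adv.deal dealt i a else honestShare ω (x i) i a
  -- Half of the ballots of each set are opened.
  let openCoins ← simBroadcast A ω.openCoin (adv.openCoin dealt)
  let half : OpenChoice n s := randomValue openCoins
  let honestOpen := fun a i k j => share i a k ((half i k).inside j)
  let opened ← simBroadcast A honestOpen (adv.openShare dealt (honestPart A ω.openCoin))
  let invalid : Finset (Fin n) := {i | ∃ k j, ¬ IsBallot (∑ a, opened a i k j)}
  -- The voters broadcast the shift values of the remaining ballots, which are then decrypted.
  let honestShift := fun i k j => ω.shift i k ((half i k).outside j)
  let view : ShiftView n r t s B A :=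
    ⟨dealt, honestPart A ω.openCoin, honestPart A honestOpen, fun i _ => honestShift i⟩
  let shift := fun i => if i ∈ B then adv.shift view i else honestShift i
  let remaining : Fin n → Fin t → Fin s → Fin s → Bins n r := fun i a k j =>
    decrypt (shift i k j) (share i a k ((half i k).outside j))
  -- For each voter, each candidate and each set, the remaining ballots are tested for equality.
  let (records, unequal) ←
    (List.finRange n ×ˢ List.finRange r ×ˢ List.finRange s).foldlM
      (eqCall adv ω view remaining) ([], ∅)
  -- The authorities broadcast which votes are revoked.
  let revoked := invalid ∪ unequal
  guard (∀ a ∈ A, ∀ i, adv.bit (view, records) a i = true ↔ i ∈ revoked)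
  -- One remaining ballot of each set of each voter that was not revoked enters the tally.
  let pickCoins ← simBroadcast A ω.pickCoin (adv.pickCoin (view, records))
  let pick : PickChoice n s := randomValue pickCoins
  let honestSum : Fin t → Fin s → Bins n r := fun a k => ∑ i ∈ revokedᶜ, remaining i a k (pick i k)
  let sums ← simBroadcast A honestSum
    (adv.tallyShare (view, records) (honestPart A ω.pickCoin))
  let Y : Fin s → Bins n r := fun k => ∑ a, sums a k
  guard (∀ k, SumConsistent (revokedᶜ).card (Y k))
  guard (∀ k, tallyOf (Y k) = tallyOf (Y 0))
  -- The authorities make the result public; the vote has failed if they do not all agree.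
  guard (∀ a ∈ A, adv.publish (view, records) (honestPart A ω.pickCoin)
    (honestPart A honestSum) a = tallyOf (Y 0))
  return ⟨tallyOf (Y 0), revoked⟩

/-- The distribution of the result of the protocol: the collusion uses a randomized strategy, the
random choices of the honest participants are uniform and independent of it. -/
noncomputable def result {B : Finset (Fin n)} {A : Finset (Fin t)} (x : Fin n → Fin r)
    (adv : PMF (Strategy n r t s B A)) : PMF (Option (Outcome n r)) :=
  adv.bind fun σ => (PMF.uniformOfFintype (Tape n r t s)).map (run x σ)

end Run

/-- The number of votes for each candidate in `y` that are not revoked. -/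
def countVotes {n r : ℕ} (y : Fin n → Fin r) (revoked : Finset (Fin n)) (c : Fin r) : ℕ :=
  (revokedᶜ.filter fun i => y i = c).card

/-- The tally counts, apart from the revoked votes, all votes `x i` of the honest voters and some
assignment of one vote to each dishonest voter. -/
def Outcome.Consistent {n r : ℕ} (B : Finset (Fin n)) (x : Fin n → Fin r) (out : Outcome n r) :
    Prop :=
  ∃ y : Fin n → Fin r, (∀ i, i ∉ B → y i = x i) ∧ out.tally = countVotes y out.revoked

end RobustVote

namespace RobustVote

open Finset

/-! For the bound on inconsistent outputs, a randomized strategy is an average of deterministic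
ones, so fix a deterministic strategy and an honest authority `h`. The tape is moved by `rebin`,
which adds `δ` to the voters' bins. In opened ballots the shift absorbs `δ`; in remaining ballots
the masks change so that only the share held by `h` differs. Nothing the collusion sees before the
final shares are revealed changes. The equality tests do not change either, because they add up all
bins of a candidate and so forget the bin (`eqInput_remaining_rebin`). Along an orbit the revoked
set, the selected ballots and the dishonest shares of the sums are therefore constant, and the sum
for set index `k` is a fixed `E k` plus the honest ballots in their moved bins
(`exists_sums_of_inconsistent`).

A successful run whose tally gives every candidate at least the unrevoked honest votes is
consistent, since the excess can be assigned to dishonest voters (`consistent_of_le`). An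
inconsistent output thus gives some candidate too few votes, and it does so in all `s` sums, whose
tallies agree. Bins in range and the modulus `2 * n + 1` exclude wraparound, so `E k`, read with
residues in `[-n, n]`, has a negative bin. This bin depends on `E k` only, and some honest ballot
must fall into it (`exists_bin_of_deficit`). Uniform bins of `n` voters miss a given bin with
probability `(1 - 1/n) ^ n ≥ 1/9`; independence over `k` gives `(8/9) ^ s` (`card_deficit_le`), and
averaging over orbits finishes the bound. As `E k` is arbitrary, the power of the tests to detect
bad ballots plays no role.

To revoke exactly the votes in `R`, one dishonest authority adds a further ballot to its shares of
the opened ballots of these voters, and the collusion otherwise follows the protocol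
(`revokingStrategy`). If all authorities are honest, every opened ballot of an honest voter is a
ballot and every tested difference is `0`, so this vote survives on every tape
(`notMem_revoked_of_honest`). -/

/-! ### The protocol in stages -/

section Stages

variable {n r t s : ℕ} {B : Finset (Fin n)} {A : Finset (Fin t)}

/-- The shares of honest ballots that the collusion receives. -/
def dealtView (B : Finset (Fin n)) (A : Finset (Fin t)) (x : Fin n → Fin r)
    (ω : Tape n r t s) : DealView n r t s B A :=
  fun i _ a _ => honestShare ω (x i) i a

/-- The shares of all ballots. -/
def shares (x : Fin n → Fin r) (adv : Strategy n r t s B A) (ω : Tape n r t s) :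
    Fin n → Fin t → Fin s → Fin (2 * s) → Bins n r := fun i a =>
  if i ∈ B then adv.deal (dealtView B A x ω) i a else honestShare ω (x i) i a

/-- The shares of the opened ballots. -/
def openedShares (x : Fin n → Fin r) (adv : Strategy n r t s B A) (ω : Tape n r t s)
    (half : OpenChoice n s) : Fin t → Fin n → Fin s → Fin s → Bins n r :=
  fun a i k j => shares x adv ω i a k ((half i k).inside j)

/-- The voters with an opened ballot that is not a ballot. -/
noncomputable def invalidVoters (opened : Fin t → Fin n → Fin s → Fin s → Bins n r) :
    Finset (Fin n) := by
  classical exact {i | ∃ k j, ¬ IsBallot (∑ a, opened a i k j)}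

/-- The shifts that honest voters apply to the ballots that are not opened. -/
def honestShifts (ω : Tape n r t s) (half : OpenChoice n s) :
    Fin n → Fin s → Fin s → Fin r × Fin n :=
  fun i k j => ω.shift i k ((half i k).outside j)

/-- What the collusion sees when the shifts are broadcast. -/
def shiftView (x : Fin n → Fin r) (adv : Strategy n r t s B A) (ω : Tape n r t s)
    (half : OpenChoice n s) : ShiftView n r t s B A :=
  ⟨dealtView B A x ω, honestPart A ω.openCoin, honestPart A (openedShares x adv ω half),
    fun i _ => honestShifts ω half i⟩

variable [NeZero s]

/-- The decrypted shares of the remaining ballots. -/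
def remaining (x : Fin n → Fin r) (adv : Strategy n r t s B A) (ω : Tape n r t s)
    (half : OpenChoice n s) : Fin n → Fin t → Fin s → Fin s → Bins n r := fun i a k j =>
  decrypt ((if i ∈ B then adv.shift (shiftView x adv ω half) i else honestShifts ω half i) k j)
    (shares x adv ω i a k ((half i k).outside j))

/-- An authority's shares of the sums of the selected ballots. -/
def selectedSum (rem : Fin n → Fin t → Fin s → Fin s → Bins n r) (revoked : Finset (Fin n))
    (pick : PickChoice n s) : Fin t → Fin s → Bins n r :=
  fun a k => ∑ i ∈ revokedᶜ, rem i a k (pick i k)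

open Classical in
/-- The part of a run that follows the equality tests. -/
noncomputable def tallyStage (adv : Strategy n r t s B A) (ω : Tape n r t s)
    (view : ShiftView n r t s B A) (rem : Fin n → Fin t → Fin s → Fin s → Bins n r)
    (records : List (EqRecord n t s A)) (revoked : Finset (Fin n)) : Option (Outcome n r) := do
  guard (∀ a ∈ A, ∀ i, adv.bit (view, records) a i = true ↔ i ∈ revoked)
  let pickCoins ← simBroadcast A ω.pickCoin (adv.pickCoin (view, records))
  let honestSum := selectedSum rem revoked (randomValue pickCoins)
  let sums ← simBroadcast A honestSum
    (adv.tallyShare (view, records) (honestPart A ω.pickCoin))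
  let Y : Fin s → Bins n r := fun k => ∑ a, sums a k
  guard (∀ k, SumConsistent (revokedᶜ).card (Y k))
  guard (∀ k, tallyOf (Y k) = tallyOf (Y 0))
  guard (∀ a ∈ A, adv.publish (view, records) (honestPart A ω.pickCoin)
    (honestPart A honestSum) a = tallyOf (Y 0))
  return ⟨tallyOf (Y 0), revoked⟩

/-- The part of a run that follows the choice of the ballots to open. -/
noncomputable def testStage (x : Fin n → Fin r) (adv : Strategy n r t s B A) (ω : Tape n r t s)
    (half : OpenChoice n s) : Option (Outcome n r) :=
  (simBroadcast A (openedShares x adv ω half)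
    (adv.openShare (dealtView B A x ω) (honestPart A ω.openCoin))).bind fun opened =>
  ((List.finRange n ×ˢ List.finRange r ×ˢ List.finRange s).foldlM
      (eqCall adv ω (shiftView x adv ω half) (remaining x adv ω half)) ([], ∅)).bind fun st =>
  tallyStage adv ω (shiftView x adv ω half) (remaining x adv ω half) st.1
    (invalidVoters opened ∪ st.2)

/-- Separates off the choice of the opened half, so that `rebin` can be taken relative to that half.
-/
theorem run_eq [NeZero n] [NeZero r] (x : Fin n → Fin r)
    (adv : Strategy n r t s B A) (ω : Tape n r t s) :
    run x adv ω = (simBroadcast A ω.openCoin (adv.openCoin (dealtView B A x ω))).bind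
      fun coins => testStage x adv ω (randomValue coins) := by
  unfold run testStage
  rfl

end Stages

/-! ### Moving the bins of the honest voters behind the back of the collusion -/

theorem Half.inside_mem {s : ℕ} (P : Half s) (j : Fin s) : P.inside j ∈ P.1 :=
  Finset.orderEmbOfFin_mem _ _ _

theorem Half.outside_notMem {s : ℕ} (P : Half s) (j : Fin s) : P.outside j ∉ P.1 :=
  Finset.mem_compl.mp (Finset.orderEmbOfFin_mem _ _ _)

/-- A change of the secret can be charged to any single authority. If `h` is not the last one, the
two occurrences of `d` cancel in the last share; if it is, its mask is unused and the last share
absorbs `d`. -/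
theorem makeADS_add {n r t : ℕ} (v d : Bins n r) (u : Fin t → Bins n r) (h a : Fin t) :
    makeADS (v + d) (fun b => u b + if b = h then d else 0) a =
      makeADS v u a + if a = h then d else 0 := by
  unfold makeADS
  by_cases ha : a.val + 1 = t
  · simp only [ha, if_true, Finset.sum_add_distrib, Finset.sum_ite_eq', Finset.mem_filter,
      Finset.mem_univ, true_and]
    by_cases hh : a = h
    · subst hh
      have : ¬ (a.val + 1 < t) := by omega
      simp only [this, if_false, if_true]
      abel
    · have : h.val + 1 < t := by
        have := h.isLt
        have : a.val ≠ h.val := fun e => hh (Fin.ext e)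
        omega
      simp only [this, hh, if_false, if_true]
      abel
  · simp only [ha, if_false]

theorem makeADS_sum {n r t : ℕ} (ht : 0 < t) (v : Bins n r) (u : Fin t → Bins n r) :
    ∑ a, makeADS v u a = v := by
  obtain ⟨t, rfl⟩ : ∃ t', t = t' + 1 := ⟨t - 1, by omega⟩
  have hf : (univ.filter fun b : Fin (t + 1) => b.val + 1 < t + 1) = univ.erase (Fin.last t) := by
    ext b
    have hb : b = Fin.last t ↔ b.val = t := by rw [Fin.ext_iff, Fin.val_last]
    have := b.isLt
    simp only [mem_filter, mem_univ, true_and, mem_erase, and_true, ne_eq, hb]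
    omega
  rw [← Finset.add_sum_erase univ _ (mem_univ (Fin.last t))]
  have hl : makeADS v u (Fin.last t) = v - ∑ b ∈ univ.erase (Fin.last t), u b := by
    rw [makeADS, if_pos (by simp), hf]
  have hr : ∑ b ∈ univ.erase (Fin.last t), makeADS v u b =
      ∑ b ∈ univ.erase (Fin.last t), u b := by
    refine Finset.sum_congr rfl fun b hb => ?_
    rw [makeADS, if_neg]
    have := (Finset.mem_erase.mp hb).1
    rw [ne_eq, Fin.ext_iff, Fin.val_last] at this
    omega
  rw [hl, hr, sub_add_cancel]

section Decrypt

variable {n r : ℕ}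

theorem decrypt_add (d : Fin r × Fin n) (v w : Bins n r) :
    decrypt d (v + w) = decrypt d v + decrypt d w := rfl

theorem decrypt_sub (d : Fin r × Fin n) (v w : Bins n r) :
    decrypt d (v - w) = decrypt d v - decrypt d w := rfl

theorem decrypt_zero (d : Fin r × Fin n) : decrypt d (0 : Bins n r) = 0 := rfl

theorem decrypt_sum {ι : Type*} (S : Finset ι) (d : Fin r × Fin n) (v : ι → Bins n r) :
    decrypt d (∑ a ∈ S, v a) = ∑ a ∈ S, decrypt d (v a) := by
  funext c o
  simp only [decrypt, Finset.sum_apply]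

theorem decrypt_ballot [NeZero n] [NeZero r] (d : Fin r × Fin n) (c : Fin r) (o : Fin n) :
    decrypt d (ballot (c + d.1) (o + d.2)) = ballot c o := by
  funext c' o'
  simp only [decrypt, ballot, add_left_inj]

/-- Adding up a candidate's bins forgets the bin, which is what makes the equality tests blind to
`rebin`. -/
theorem sum_ballot (c : Fin r) (o : Fin n) (c' : Fin r) :
    ∑ o', (ballot c o : Bins n r) c' o' = if c' = c then 1 else 0 := by
  unfold ballot
  by_cases h : c' = c <;> simp [h]

end Decrypt

section Rebin

variable {n r t s : ℕ} {B : Finset (Fin n)} {A : Finset (Fin t)}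

/-- Add `δ` to the bins of the voters. This is made invisible in the opened ballots by another
shift, and in the remaining ballots by a change of the share of authority `h` only. -/
def rebin (x : Fin n → Fin r) (h : Fin t) (half : OpenChoice n s) (δ : Fin n → Fin s → Fin n)
    (ω : Tape n r t s) : Tape n r t s where
  bin i k := ω.bin i k + δ i k
  shift i k j := if j ∈ (half i k).1 then ((ω.shift i k j).1, (ω.shift i k j).2 - δ i k)
    else ω.shift i k j
  mask i k j a := if j ∈ (half i k).1 then ω.mask i k j a else ω.mask i k j a +
    if a = h then ballot (x i + (ω.shift i k j).1) (ω.bin i k + δ i k + (ω.shift i k j).2) -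
      ballot (x i + (ω.shift i k j).1) (ω.bin i k + (ω.shift i k j).2) else 0
  openCoin := ω.openCoin
  eqCoin := ω.eqCoin
  pickCoin := ω.pickCoin

variable (x : Fin n → Fin r) (h : Fin t) (half : OpenChoice n s) (δ : Fin n → Fin s → Fin n)
  (ω : Tape n r t s)

/-- The two corrections of the mask of `h` telescope, because shifts outside the opened half do not
move. This yields the injectivity needed to average over orbits. -/
theorem rebin_neg_rebin [NeZero n] : rebin x h half (-δ) (rebin x h half δ ω) = ω := by
  refine Tape.ext ?_ ?_ ?_ rfl rfl rfl
  · funext i k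
    simp [rebin]
  · funext i k j
    simp only [rebin]
    split_ifs <;> simp
  · funext i k j a
    simp only [rebin]
    (split_ifs <;> simp); abel

/-- Only bin plus shift enters the dealt ballot, and in the opened half the two changes cancel. -/
theorem honestShare_rebin_of_mem [NeZero n] (i : Fin n) (a : Fin t) (k : Fin s) {j : Fin (2 * s)}
    (hj : j ∈ (half i k).1) :
    honestShare (rebin x h half δ ω) (x i) i a k j = honestShare ω (x i) i a k j := by
  have hm : (rebin x h half δ ω).mask i k j = ω.mask i k j := by
    funext b
    simp only [rebin, if_pos hj]
  rw [honestShare, honestShare, hm]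
  simp only [rebin, if_pos hj]
  congr 2
  abel

theorem honestShare_rebin_of_notMem (i : Fin n) (a : Fin t) (k : Fin s) {j : Fin (2 * s)}
    (hj : j ∉ (half i k).1) :
    honestShare (rebin x h half δ ω) (x i) i a k j = honestShare ω (x i) i a k j +
      if a = h then ballot (x i + (ω.shift i k j).1) (ω.bin i k + δ i k + (ω.shift i k j).2) -
        ballot (x i + (ω.shift i k j).1) (ω.bin i k + (ω.shift i k j).2) else 0 := by
  rw [honestShare, honestShare, ← makeADS_add]
  congr 1
  · simp only [rebin, if_neg hj, add_sub_cancel]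
  · funext b
    simp only [rebin, if_neg hj]

variable (adv : Strategy n r t s B A)

variable {h}

theorem dealtView_rebin [NeZero n] (hA : h ∉ A) :
    dealtView B A x (rebin x h half δ ω) = dealtView B A x ω := by
  funext i _ a ha k j
  have hah : a ≠ h := fun e => hA (e ▸ ha)
  by_cases hj : j ∈ (half i k).1
  · exact honestShare_rebin_of_mem x h half δ ω i a k hj
  · refine (honestShare_rebin_of_notMem x h half δ ω i a k hj).trans ?_
    rw [if_neg hah, add_zero]
    rfl

theorem openedShares_rebin [NeZero n] (hA : h ∉ A) :
    openedShares x adv (rebin x h half δ ω) half = openedShares x adv ω half := by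
  funext a i k j
  simp only [openedShares, shares, dealtView_rebin x half δ ω hA]
  split_ifs
  · rfl
  · exact honestShare_rebin_of_mem x h half δ ω i a k (Half.inside_mem _ _)

theorem honestShifts_rebin :
    honestShifts (rebin x h half δ ω) half = honestShifts ω half := by
  funext i k j
  simp only [honestShifts, rebin, if_neg (Half.outside_notMem _ _)]

theorem shiftView_rebin [NeZero n] (hA : h ∉ A) :
    shiftView x adv (rebin x h half δ ω) half = shiftView x adv ω half := by
  simp only [shiftView, dealtView_rebin x half δ ω hA, openedShares_rebin x half δ ω adv hA,
    honestShifts_rebin]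
  rfl

/-- Decryption removes the shift from the correction held by `h`, leaving a difference of two
unshifted ballots for the same candidate. -/
theorem remaining_rebin [NeZero n] [NeZero r] (hA : h ∉ A) (i : Fin n) (a : Fin t) (k j : Fin s) :
    remaining x adv (rebin x h half δ ω) half i a k j = remaining x adv ω half i a k j +
      if i ∉ B ∧ a = h then ballot (x i) (ω.bin i k + δ i k) - ballot (x i) (ω.bin i k)
      else 0 := by
  simp only [remaining, shares, dealtView_rebin x half δ ω hA, shiftView_rebin x half δ ω adv hA,
    honestShifts_rebin]
  by_cases hi : i ∈ B
  · simp only [hi, if_true, not_true_eq_false, false_and, if_false, add_zero]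
  · simp only [hi, if_false, not_false_eq_true, true_and,
      honestShare_rebin_of_notMem x h half δ ω i a k (Half.outside_notMem _ _), decrypt_add]
    congr 1
    by_cases ha : a = h
    · simp only [ha, if_true, decrypt_sub, honestShifts, decrypt_ballot]
    · simp only [ha, if_false, decrypt_zero]

theorem eqInput_remaining_rebin [NeZero n] [NeZero r] [NeZero s] (hA : h ∉ A)
    (i : Fin n) (a : Fin t) :
    eqInput (remaining x adv (rebin x h half δ ω) half i a) =
      eqInput (remaining x adv ω half i a) := by
  have key : ∀ k j c, ∑ o, remaining x adv (rebin x h half δ ω) half i a k j c o =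
      ∑ o, remaining x adv ω half i a k j c o := by
    intro k j c
    simp only [remaining_rebin x half δ ω adv hA, Pi.add_apply, Finset.sum_add_distrib]
    split_ifs
    · simp only [Pi.sub_apply, Finset.sum_sub_distrib, sum_ballot, sub_self, add_zero]
    · simp
  funext c k j
  simp only [eqInput, key]

/-- Consequently the records of the tests and the set of voters failing them are constant along an
orbit. -/
theorem eqCall_rebin [NeZero n] [NeZero r] [NeZero s] (hA : h ∉ A) :
    eqCall adv (rebin x h half δ ω) (shiftView x adv (rebin x h half δ ω) half)
        (remaining x adv (rebin x h half δ ω) half) =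
      eqCall adv ω (shiftView x adv ω half) (remaining x adv ω half) := by
  funext st q
  simp only [eqCall, shiftView_rebin x half δ ω adv hA, eqInput_remaining_rebin x half δ ω adv hA]
  rfl

end Rebin

/-! ### Hitting the bins of the honest voters is a matter of luck -/

/-- With `k = n - 1`, the ratio is `(1 + 1/k) ^ (k + 1) ≤ exp (1 + 1/k) ≤ exp 2 < 9`. This is the
source of the constant `8/9`. -/
theorem pow_le_nine_mul_pow {n : ℕ} (hn : 2 ≤ n) : n ^ n ≤ 9 * (n - 1) ^ n := by
  obtain ⟨k, rfl⟩ : ∃ k, n = k + 1 := ⟨n - 1, by omega⟩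
  have hk : 1 ≤ k := by omega
  have hk' : (0 : ℝ) < k := by exact_mod_cast hk
  rw [Nat.add_sub_cancel]
  have h1 : ((k : ℝ) + 1) / k ≤ Real.exp (1 / k) := by
    have := Real.add_one_le_exp (1 / (k : ℝ))
    calc ((k : ℝ) + 1) / k = 1 / k + 1 := by rw [add_div, div_self hk'.ne', add_comm]
      _ ≤ _ := this
  have h2 : (((k : ℝ) + 1) / k) ^ (k + 1) ≤ 9 := by
    calc (((k : ℝ) + 1) / k) ^ (k + 1) ≤ Real.exp (1 / k) ^ (k + 1) :=
          pow_le_pow_left₀ (by positivity) h1 _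
      _ = Real.exp (1 + 1 / k) := by
          rw [← Real.exp_nat_mul]
          congr 1
          push_cast
          field_simp
      _ ≤ Real.exp 2 := by
          apply Real.exp_le_exp.mpr
          have : 1 / (k : ℝ) ≤ 1 := by
            rw [div_le_one hk']
            exact_mod_cast hk
          linarith
      _ = Real.exp 1 * Real.exp 1 := by rw [← Real.exp_add]; norm_num
      _ ≤ 3 * 3 := by
          have := Real.exp_one_lt_d9
          have h0 := Real.exp_pos 1
          apply mul_le_mul <;> linarith
      _ = 9 := by norm_num
  rw [div_pow, div_le_iff₀ (by positivity)] at h2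
  exact_mod_cast h2

/-- The `(n - 1) ^ n` maps that avoid `o` make up at least a ninth of all maps. -/
theorem card_hit_le {n : ℕ} (hn : 2 ≤ n) (o : Fin n) (G : Finset (Fin n → Fin n))
    (hG : ∀ β ∈ G, ∃ i, β i = o) : (G.card : ℝ) ≤ 8 / 9 * (n : ℝ) ^ n := by
  have hsub : G ⊆ (Fintype.piFinset fun _ : Fin n => ({o}ᶜ : Finset (Fin n)))ᶜ := by
    intro β hβ
    obtain ⟨i, hi⟩ := hG β hβ
    rw [Finset.mem_compl, Fintype.mem_piFinset]
    intro h
    exact (Finset.mem_compl.mp (h i)) (Finset.mem_singleton.mpr hi)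
  have h1 := Finset.card_le_card hsub
  have h2 := Finset.card_add_card_compl
    (Fintype.piFinset fun _ : Fin n => ({o}ᶜ : Finset (Fin n)))
  simp only [Fintype.card_piFinset, Finset.card_compl, Finset.card_singleton, Fintype.card_fin,
    Finset.prod_const, Finset.card_univ, Fintype.card_pi] at h1 h2
  have h3 := pow_le_nine_mul_pow hn
  have h4 : 9 * G.card ≤ 8 * n ^ n := by
    generalize n ^ n = N at *
    generalize (n - 1) ^ n = M at *
    omega
  have h5 : (9 : ℝ) * G.card ≤ 8 * (n : ℝ) ^ n := by exact_mod_cast h4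
  linarith

/-! ### Sums of ballots as integers, and deficits -/

section Sums

variable {n r : ℕ}

/-- The number of ballots in bin `o` of candidate `c`. -/
def binCount (S : Finset (Fin n)) (x : Fin n → Fin r) (β : Fin n → Fin n) (c : Fin r)
    (o : Fin n) : ℕ :=
  (S.filter fun i => c = x i ∧ o = β i).card

theorem sum_ballot_apply (S : Finset (Fin n)) (x : Fin n → Fin r) (β : Fin n → Fin n)
    (c : Fin r) (o : Fin n) :
    (∑ i ∈ S, (ballot (x i) (β i) : Bins n r)) c o = (binCount S x β c o : ZMod (2 * n + 1)) := by
  simp only [Finset.sum_apply, ballot, binCount, Finset.card_filter]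
  push_cast
  rfl

theorem binCount_le (S : Finset (Fin n)) (x : Fin n → Fin r) (β : Fin n → Fin n) (c : Fin r)
    (o : Fin n) : binCount S x β c o ≤ n :=
  (Finset.card_le_univ _).trans_eq (Fintype.card_fin n)

theorem sum_binCount (S : Finset (Fin n)) (x : Fin n → Fin r) (β : Fin n → Fin n) (c : Fin r) :
    ∑ o, binCount S x β c o = (S.filter fun i => c = x i).card := by
  rw [Finset.card_eq_sum_card_fiberwise (f := β) (t := univ) (fun _ _ => mem_univ _)]
  refine Finset.sum_congr rfl fun o _ => ?_
  rw [binCount, Finset.filter_filter]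
  simp only [eq_comm]

/-- If all bins are in range, then no reduction modulo `2 * n + 1` takes place when honest ballots
are added to the other contributions. -/
theorem val_eq_of_val_le {e : ZMod (2 * n + 1)} {a : ℕ} (ha : a ≤ n)
    (hv : (e + (a : ZMod (2 * n + 1))).val ≤ n) :
    ((e + (a : ZMod (2 * n + 1))).val : ℤ) = e.valMinAbs + a := by
  set w := (e + (a : ZMod (2 * n + 1))).val with hw
  -- Both `w` and `a` lie in `[0, n]`, so `w - a` lies in `[-n, n]`, exactly the range of minimal
  -- representatives modulo `2 * n + 1`.
  have h : e.valMinAbs = (w : ℤ) - a := by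
    rw [ZMod.valMinAbs_spec]
    constructor
    · push_cast
      rw [hw, ZMod.natCast_zmod_val]
      ring
    · constructor
      · push_cast
        omega
      · push_cast
        omega
  omega

/-- A bin that has to be hit: if the other contributions `E` can be completed to consistent sums
that take a vote away from the ballots in `S`, then one and the same bin contains a ballot
in every consistent completion. -/
theorem exists_bin_of_deficit {S : Finset (Fin n)} {x : Fin n → Fin r} {E : Bins n r} {N : ℕ}
    {β₀ : Fin n → Fin n}
    (h₀ : SumConsistent N (E + ∑ i ∈ S, ballot (x i) (β₀ i)))
    (hc : ∃ c, tallyOf (E + ∑ i ∈ S, ballot (x i) (β₀ i)) c < (S.filter fun i => c = x i).card) :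
    ∃ o, ∀ (N' : ℕ) (β : Fin n → Fin n), SumConsistent N' (E + ∑ i ∈ S, ballot (x i) (β i)) →
      ∃ i, β i = o := by
  have key : ∀ (N' : ℕ) (β : Fin n → Fin n),
      SumConsistent N' (E + ∑ i ∈ S, ballot (x i) (β i)) → ∀ c o,
      (((E + ∑ i ∈ S, ballot (x i) (β i)) c o).val : ℤ) =
        (E c o).valMinAbs + binCount S x β c o := by
    intro N' β hβ c o
    have h := hβ.1 c o
    rw [Pi.add_apply, Pi.add_apply, sum_ballot_apply] at h ⊢
    exact val_eq_of_val_le (binCount_le S x β c o) h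
  obtain ⟨c, hc⟩ := hc
  -- As integers, the tally of `c` is the sum of these residues plus the votes for `c` in `S`.
  have hneg : ∑ o, (E c o).valMinAbs < 0 := by
    have h1 : (tallyOf (E + ∑ i ∈ S, ballot (x i) (β₀ i)) c : ℤ) =
        ∑ o, (E c o).valMinAbs + ((S.filter fun i => c = x i).card : ℤ) := by
      rw [← sum_binCount S x β₀ c, tallyOf]
      push_cast
      rw [← Finset.sum_add_distrib]
      exact Finset.sum_congr rfl fun o _ => key N β₀ h₀ c o
    have h2 : (tallyOf (E + ∑ i ∈ S, ballot (x i) (β₀ i)) c : ℤ) <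
        ((S.filter fun i => c = x i).card : ℤ) := by exact_mod_cast hc
    omega
  -- The negative bin is a feature of `E` alone; any other consistent completion must also lift it
  -- to at least `0`, hence put a ballot there.
  obtain ⟨o, -, ho⟩ : ∃ o ∈ (univ : Finset (Fin n)), (E c o).valMinAbs < 0 := by
    by_contra! hcon
    exact absurd (Finset.sum_nonneg hcon) (not_le.mpr hneg)
  refine ⟨o, fun N' β hβ => ?_⟩
  have h := key N' β hβ c o
  have hpos : 0 < binCount S x β c o := by omega
  obtain ⟨i, hi⟩ := Finset.card_pos.mp hpos
  exact ⟨i, (Finset.mem_filter.mp hi).2.2.symm⟩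

end Sums

open Classical in
/-- With independent uniform bins of the ballots, the probability that all of the given sums can be
consistent and take a vote away from the ballots in `S` is exponentially small. -/
theorem card_deficit_le {n r s : ℕ} (hn : 2 ≤ n) (S : Finset (Fin n)) (x : Fin n → Fin r)
    (E : Fin s → Bins n r) (N : ℕ) :
    ((univ.filter fun β : Fin n → Fin s → Fin n => ∀ k,
      SumConsistent N (E k + ∑ i ∈ S, ballot (x i) (β i k)) ∧
      ∃ c, tallyOf (E k + ∑ i ∈ S, ballot (x i) (β i k)) c <
        (S.filter fun i => c = x i).card).card : ℝ) ≤
      (8 / 9) ^ s * (Fintype.card (Fin n → Fin s → Fin n) : ℝ) := by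
  let G : Fin s → Finset (Fin n → Fin n) := fun k => univ.filter fun β =>
    SumConsistent N (E k + ∑ i ∈ S, ballot (x i) (β i)) ∧
      ∃ c, tallyOf (E k + ∑ i ∈ S, ballot (x i) (β i)) c < (S.filter fun i => c = x i).card
  have hG : ∀ k, ((G k).card : ℝ) ≤ 8 / 9 * (n : ℝ) ^ n := by
    intro k
    -- Any element of `G k` can serve as the reference that determines the bin to be hit.
    rcases (G k).eq_empty_or_nonempty with h | ⟨β₀, h₀⟩
    · rw [h, Finset.card_empty, Nat.cast_zero]
      positivity
    · have h₀ := (Finset.mem_filter.mp h₀).2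
      obtain ⟨o, ho⟩ := exists_bin_of_deficit h₀.1 h₀.2
      exact card_hit_le hn o (G k) fun β hβ => ho N β (Finset.mem_filter.mp hβ).2.1
  have hle : (univ.filter fun β : Fin n → Fin s → Fin n => ∀ k,
      SumConsistent N (E k + ∑ i ∈ S, ballot (x i) (β i k)) ∧
      ∃ c, tallyOf (E k + ∑ i ∈ S, ballot (x i) (β i k)) c <
        (S.filter fun i => c = x i).card).card ≤ (Fintype.piFinset G).card := by
    -- The conditions for different `k` involve disjoint coordinates of `β`, so the count is bounded
    -- by a product.
    refine Finset.card_le_card_of_injOn (fun β k i => β i k) ?_ ?_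
    · intro β hβ
      have hβ := (Finset.mem_filter.mp hβ).2
      rw [Finset.mem_coe, Fintype.mem_piFinset]
      intro k
      exact Finset.mem_filter.mpr ⟨mem_univ _, hβ k⟩
    · intro β _ β' _ hh
      funext i k
      exact congrFun (congrFun hh k) i
  calc _ ≤ ((Fintype.piFinset G).card : ℝ) := by exact_mod_cast hle
    _ = ∏ k, ((G k).card : ℝ) := by rw [Fintype.card_piFinset, Nat.cast_prod]
    _ ≤ ∏ _k : Fin s, (8 / 9 * (n : ℝ) ^ n) :=
        Finset.prod_le_prod (fun _ _ => by positivity) fun k _ => hG k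
    _ = (8 / 9) ^ s * (Fintype.card (Fin n → Fin s → Fin n) : ℝ) := by
        rw [Finset.prod_const, Finset.card_univ, Fintype.card_fin, mul_pow]
        simp only [Fintype.card_pi, Fintype.card_fin, Finset.prod_const, Finset.card_univ]
        push_cast
        rw [← pow_mul, ← pow_mul, Nat.mul_comm]

/-- If the orbit of every point under a family of injections meets a set with frequency at most
`q`, then the frequency of the set is at most `q`. -/
theorem card_le_of_orbit_card_le {Ω D : Type*} [Fintype Ω] [Fintype D] [Nonempty D]
    (act : D → Ω → Ω) (hact : ∀ d, Function.Injective (act d)) (p : Ω → Prop)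
    [DecidablePred p] (q : ℝ)
    (h : ∀ ω, ((univ.filter fun d => p (act d ω)).card : ℝ) ≤ q * Fintype.card D) :
    ((univ.filter p).card : ℝ) ≤ q * Fintype.card Ω := by
  have h1 : ∀ d, (univ.filter fun ω => p (act d ω)).card = (univ.filter p).card := by
    intro d
    have hb : Function.Bijective (act d) := Finite.injective_iff_bijective.mp (hact d)
    exact Finset.card_bijective (act d) hb (by simp)
  -- Double counting of the pairs `(d, ω)` with `p (act d ω)`.
  have h2 : ∑ d, (univ.filter fun ω => p (act d ω)).card =
      ∑ ω, (univ.filter fun d => p (act d ω)).card := by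
    simp only [Finset.card_filter]
    exact Finset.sum_comm
  have h3 : (Fintype.card D : ℝ) * (univ.filter p).card ≤
      Fintype.card D * (q * Fintype.card Ω) := by
    calc (Fintype.card D : ℝ) * (univ.filter p).card
        = ((∑ d : D, (univ.filter fun ω => p (act d ω)).card : ℕ) : ℝ) := by
          simp only [h1, Finset.sum_const, Finset.card_univ, smul_eq_mul]
          push_cast
          rfl
      _ = ∑ ω, ((univ.filter fun d => p (act d ω)).card : ℝ) := by
          rw [h2]
          push_cast
          rfl
      _ ≤ ∑ _ω : Ω, q * Fintype.card D := Finset.sum_le_sum fun ω _ => h ω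
      _ = _ := by
          rw [Finset.sum_const, Finset.card_univ, nsmul_eq_mul]
          ring
  have hD : (0 : ℝ) < Fintype.card D := by exact_mod_cast Fintype.card_pos
  exact le_of_mul_le_mul_left h3 hD

/-! ### Consistency of the output -/

/-- Induction on `D`: a new element is given any value `c₀` with `f c₀ ≠ 0`, and `f c₀` is lowered
by one. -/
theorem exists_assignment {ι κ : Type*} [DecidableEq ι] [Fintype κ] [DecidableEq κ]
    (x : ι → κ) (D : Finset ι) (f : κ → ℕ) (hf : ∑ c, f c = D.card) :
    ∃ y : ι → κ, (∀ i, i ∉ D → y i = x i) ∧ ∀ c, (D.filter fun i => y i = c).card = f c := by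
  induction D using Finset.induction generalizing f with
  | empty =>
    refine ⟨x, fun _ _ => rfl, fun c => ?_⟩
    rw [Finset.card_empty, Finset.sum_eq_zero_iff] at hf
    simp [hf c (mem_univ c)]
  | insert a D ha ih =>
    rw [Finset.card_insert_of_notMem ha] at hf
    obtain ⟨c₀, -, hc₀⟩ : ∃ c ∈ (univ : Finset κ), f c ≠ 0 := by
      by_contra! hcon
      rw [Finset.sum_eq_zero hcon] at hf
      omega
    have hf' : ∑ c, (f c - if c = c₀ then 1 else 0) = D.card := by
      have : ∑ c, ((f c - if c = c₀ then 1 else 0) + if c = c₀ then 1 else 0) = ∑ c, f c := by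
        refine Finset.sum_congr rfl fun c _ => ?_
        by_cases h : c = c₀
        · subst h
          simp only [if_true]
          omega
        · simp [h]
      rw [Finset.sum_add_distrib, Finset.sum_ite_eq' univ c₀, if_pos (mem_univ _)] at this
      omega
    obtain ⟨y, hy, hy'⟩ := ih _ hf'
    refine ⟨Function.update y a c₀, fun i hi => ?_, fun c => ?_⟩
    · rw [Finset.mem_insert, not_or] at hi
      rw [Function.update_of_ne hi.1, hy i hi.2]
    · have h1 : (D.filter fun i => Function.update y a c₀ i = c) = D.filter fun i => y i = c := by
        refine Finset.filter_congr fun i hi => ?_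
        rw [Function.update_of_ne (ne_of_mem_of_not_mem hi ha)]
      rw [Finset.filter_insert, h1, Function.update_self]
      by_cases h : c₀ = c
      · subst h
        rw [if_pos rfl, Finset.card_insert_of_notMem (fun e => ha (Finset.mem_filter.mp e).1),
          hy', if_pos rfl]
        omega
      · rw [if_neg h, hy', if_neg (fun e => h e.symm)]
        rfl

/-- An output whose tallies add up to the number of votes and that gives every candidate the
honest votes is consistent. -/
theorem consistent_of_le {n r : ℕ} {B : Finset (Fin n)} {x : Fin n → Fin r} {out : Outcome n r}
    (hsum : ∑ c, out.tally c = out.revokedᶜ.card)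
    (hle : ∀ c, ((out.revokedᶜ \ B).filter fun i => c = x i).card ≤ out.tally c) :
    out.Consistent B x := by
  have hN : ∑ c, ((out.revokedᶜ \ B).filter fun i => c = x i).card = (out.revokedᶜ \ B).card := by
    rw [Finset.card_eq_sum_card_fiberwise (f := x) (t := univ) (fun _ _ => mem_univ _)]
    simp only [eq_comm]
  have hD : (out.revokedᶜ ∩ B).card + (out.revokedᶜ \ B).card = out.revokedᶜ.card :=
    Finset.card_inter_add_card_sdiff _ _
  -- The dishonest voters whose votes count receive the excess of the tally over the honest votes.
  obtain ⟨y, hy, hy'⟩ := exists_assignment x (out.revokedᶜ ∩ B)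
    (fun c => out.tally c - ((out.revokedᶜ \ B).filter fun i => c = x i).card) (by
      have : ∑ c, (out.tally c - ((out.revokedᶜ \ B).filter fun i => c = x i).card) +
          ∑ c, ((out.revokedᶜ \ B).filter fun i => c = x i).card = ∑ c, out.tally c := by
        rw [← Finset.sum_add_distrib]
        exact Finset.sum_congr rfl fun c _ => Nat.sub_add_cancel (hle c)
      omega)
  refine ⟨y, fun i hi => hy i fun h => hi (Finset.mem_inter.mp h).2, funext fun c => ?_⟩
  have h1 : (out.revokedᶜ.filter fun i => y i = c).card =
      ((out.revokedᶜ ∩ B).filter fun i => y i = c).card +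
        ((out.revokedᶜ \ B).filter fun i => y i = c).card := by
    rw [← Finset.card_union_of_disjoint, ← Finset.filter_union, Finset.union_comm,
      Finset.sdiff_union_inter]
    exact Finset.disjoint_filter_filter (Finset.disjoint_sdiff_inter _ _).symm
  have h2 : ((out.revokedᶜ \ B).filter fun i => y i = c) =
      (out.revokedᶜ \ B).filter fun i => c = x i := by
    refine Finset.filter_congr fun i hi => ?_
    rw [hy i fun h => (Finset.mem_sdiff.mp hi).2 (Finset.mem_inter.mp h).2, eq_comm]
  have := hle c
  rw [countVotes, h1, hy', h2]
  omega

theorem SumConsistent.sum_tallyOf {n r N : ℕ} {Y : Bins n r} (h : SumConsistent N Y) :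
    ∑ c, tallyOf Y c = N := h.2

/-! ### The effect of moving bins on the sums of the selected ballots -/

theorem simBroadcast_eq_some {t : ℕ} {A : Finset (Fin t)} {M : Type} {f g : Fin t → M}
    {adv : Fin t → Option M} (h : simBroadcast A f adv = some g) :
    (∀ a ∈ A, adv a = some (g a)) ∧ ∀ a, a ∉ A → g a = f a := by
  unfold simBroadcast at h
  split_ifs at h with hs
  cases h
  refine ⟨fun a ha => ?_, fun a ha => if_neg ha⟩
  obtain ⟨v, hv⟩ := Option.isSome_iff_exists.mp (hs a ha)
  simp [ha, hv]

section Failure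

variable {n r t s : ℕ} {B : Finset (Fin n)} {A : Finset (Fin t)}

/-- The moved bins enter the revealed sums only through the share of `h`, which the collusion cannot
see when it commits to its own shares. -/
theorem selectedSum_rebin [NeZero n] [NeZero r] (x : Fin n → Fin r) {h : Fin t}
    (half : OpenChoice n s)
    (δ : Fin n → Fin s → Fin n) (ω : Tape n r t s) (adv : Strategy n r t s B A) (hA : h ∉ A)
    (R : Finset (Fin n)) (pick : PickChoice n s) (a : Fin t) (k : Fin s) :
    selectedSum (remaining x adv (rebin x h half δ ω) half) R pick a k =
      selectedSum (remaining x adv ω half) R pick a k +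
        if a = h then ∑ i ∈ Rᶜ \ B, (ballot (x i) (ω.bin i k + δ i k) - ballot (x i) (ω.bin i k))
        else 0 := by
  simp only [selectedSum, remaining_rebin x half δ ω adv hA, Finset.sum_add_distrib]
  congr 1
  by_cases ha : a = h
  · simp only [ha, and_true, if_true, ← Finset.sum_filter]
    refine Finset.sum_congr ?_ fun _ _ => rfl
    ext i
    simp
  · simp [ha]

/-- What a successful run has passed after the equality tests. -/
theorem tallyStage_eq_some [NeZero s] {adv : Strategy n r t s B A}
    {ω : Tape n r t s} {view : ShiftView n r t s B A}
    {rem : Fin n → Fin t → Fin s → Fin s → Bins n r} {records : List (EqRecord n t s A)}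
    {revoked : Finset (Fin n)} {out : Outcome n r}
    (h : tallyStage adv ω view rem records revoked = some out) :
    ∃ coins, simBroadcast A ω.pickCoin (adv.pickCoin (view, records)) = some coins ∧
    ∃ sums, simBroadcast A (selectedSum rem revoked (randomValue coins))
      (adv.tallyShare (view, records) (honestPart A ω.pickCoin)) = some sums ∧
    (∀ k, SumConsistent revokedᶜ.card (∑ a, sums a k)) ∧
    (∀ k, tallyOf (∑ a, sums a k) = out.tally) ∧ out.revoked = revoked := by
  classical
  simp only [tallyStage, Option.bind_eq_bind, Option.bind_eq_some_iff, Option.guard_eq_some',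
    Option.pure_def, Option.some.injEq] at h
  obtain ⟨-, -, coins, hcoins, sums, hsums, -, h1, -, h2, -, -, rfl⟩ := h
  exact ⟨coins, hcoins, sums, hsums, h1, h2, rfl⟩

/-- The half of the ballots that is opened, if this part of the protocol succeeds. -/
noncomputable def openedHalf [NeZero n] [NeZero s] (x : Fin n → Fin r)
    (adv : Strategy n r t s B A) (ω : Tape n r t s) : OpenChoice n s :=
  -- The default only makes the half total; it is reached when the broadcast aborts, and the run
  -- with it.
  randomValue ((simBroadcast A ω.openCoin (adv.openCoin (dealtView B A x ω))).getD ω.openCoin)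

/-- The half is determined by coins and dealt shares, so `rebin` may be taken relative to the half
of the tape it acts on, and the original half can be recovered from the moved tape. -/
theorem openedHalf_rebin [NeZero n] [NeZero s] (x : Fin n → Fin r) {h : Fin t} (hA : h ∉ A)
    (half : OpenChoice n s) (δ : Fin n → Fin s → Fin n) (ω : Tape n r t s) (adv : Strategy n r t s B A) :
    openedHalf x adv (rebin x h half δ ω) = openedHalf x adv ω := by
  simp only [openedHalf, dealtView_rebin x half δ ω hA]
  rfl

/-! ### Averaging over the orbits of `rebin` -/

variable [NeZero n] [NeZero r] [NeZero s]

/-- Everything up to the tally is expressed through `ω` alone; `δ` survives only in the remaining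
ballots given to `tallyStage`. -/
theorem testStage_rebin_eq_some {x : Fin n → Fin r} {h : Fin t} (hA : h ∉ A)
    {δ : Fin n → Fin s → Fin n} {ω : Tape n r t s} {adv : Strategy n r t s B A}
    {out : Outcome n r} (hrun : run x adv (rebin x h (openedHalf x adv ω) δ ω) = some out) :
    ∃ opened, simBroadcast A (openedShares x adv ω (openedHalf x adv ω))
        (adv.openShare (dealtView B A x ω) (honestPart A ω.openCoin)) = some opened ∧
    ∃ st, (List.finRange n ×ˢ List.finRange r ×ˢ List.finRange s).foldlM
        (eqCall adv ω (shiftView x adv ω (openedHalf x adv ω))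
          (remaining x adv ω (openedHalf x adv ω))) ([], ∅) = some st ∧
    tallyStage adv ω (shiftView x adv ω (openedHalf x adv ω))
      (remaining x adv (rebin x h (openedHalf x adv ω) δ ω) (openedHalf x adv ω)) st.1
      (invalidVoters opened ∪ st.2) = some out := by
  rw [run_eq, Option.bind_eq_some_iff] at hrun
  obtain ⟨coins, hcoins, hrun⟩ := hrun
  have hhalf : randomValue coins = openedHalf x adv ω := by
    rw [← openedHalf_rebin x hA (openedHalf x adv ω) δ ω adv, openedHalf, hcoins]
    rfl
  rw [hhalf, testStage, Option.bind_eq_some_iff] at hrun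
  obtain ⟨opened, hopened, hrun⟩ := hrun
  rw [eqCall_rebin x _ δ ω adv hA, Option.bind_eq_some_iff] at hrun
  obtain ⟨st, hst, hrun⟩ := hrun
  rw [openedShares_rebin x _ δ ω adv hA, dealtView_rebin x _ δ ω hA] at hopened
  rw [shiftView_rebin x _ δ ω adv hA] at hrun
  exact ⟨opened, hopened, st, hst, hrun⟩

/-- Whatever the fixed random choices are, only few positions of the honest bins let the run
succeed with an inconsistent output. -/
theorem exists_sums_of_inconsistent (x : Fin n → Fin r) {h : Fin t} (hA : h ∉ A)
    (ω : Tape n r t s) (adv : Strategy n r t s B A) :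
    ∃ (S : Finset (Fin n)) (E : Fin s → Bins n r) (N : ℕ), ∀ δ : Fin n → Fin s → Fin n,
      (∃ out, run x adv (rebin x h (openedHalf x adv ω) δ ω) = some out ∧
        ¬ out.Consistent B x) →
      ∀ k, SumConsistent N (E k + ∑ i ∈ S, ballot (x i) (ω.bin i k + δ i k)) ∧
        ∃ c, tallyOf (E k + ∑ i ∈ S, ballot (x i) (ω.bin i k + δ i k)) c <
          (S.filter fun i => c = x i).card := by
  -- One successful `δ₀` supplies the opened shares, the test results and the coins; these are the
  -- same for every successful `δ`.
  by_cases hne : ∃ δ out, run x adv (rebin x h (openedHalf x adv ω) δ ω) = some out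
  swap
  · refine ⟨∅, 0, 0, fun δ hδ => ?_⟩
    obtain ⟨out, hout, -⟩ := hδ
    exact absurd ⟨δ, out, hout⟩ hne
  obtain ⟨δ₀, out₀, h₀⟩ := hne
  obtain ⟨opened, hopened, st, hst, h₀⟩ := testStage_rebin_eq_some hA h₀
  obtain ⟨coins, hcoins, -⟩ := tallyStage_eq_some h₀
  set half := openedHalf x adv ω with hhalf
  set view := shiftView x adv ω half with hview
  set R := invalidVoters opened ∪ st.2 with hR
  set false_share := adv.tallyShare (view, st.1) (honestPart A ω.pickCoin)
  -- `E k` is the sum revealed for `ω`, with the honest ballots in their original bins taken out.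
  -- The default `0` is harmless, since a refusal aborts the run.
  refine ⟨Rᶜ \ B, fun k => ∑ a, (if a ∈ A then (false_share a).getD 0 k else
      selectedSum (remaining x adv ω half) R (randomValue coins) a k) -
      ∑ i ∈ Rᶜ \ B, ballot (x i) (ω.bin i k), Rᶜ.card, ?_⟩
  rintro δ ⟨out, hout, hinc⟩ k
  obtain ⟨opened', hopened', st', hst', hout⟩ := testStage_rebin_eq_some hA hout
  obtain rfl : opened = opened' := Option.some.inj (hopened.symm.trans hopened')
  obtain rfl : st = st' := Option.some.inj (hst.symm.trans hst')
  obtain ⟨coins', hcoins', sums, hsums, hcons, htally, hrev⟩ := tallyStage_eq_some hout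
  obtain rfl : coins = coins' := Option.some.inj (hcoins.symm.trans hcoins')
  have hY : ∑ a, sums a k = ∑ a, (if a ∈ A then (false_share a).getD 0 k else
      selectedSum (remaining x adv ω half) R (randomValue coins) a k) -
      ∑ i ∈ Rᶜ \ B, ballot (x i) (ω.bin i k) +
      ∑ i ∈ Rᶜ \ B, ballot (x i) (ω.bin i k + δ i k) := by
    obtain ⟨hs1, hs2⟩ := simBroadcast_eq_some hsums
    have hterm : ∀ a, sums a k = (if a ∈ A then (false_share a).getD 0 k else
        selectedSum (remaining x adv ω half) R (randomValue coins) a k) +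
        if a = h then ∑ i ∈ Rᶜ \ B,
          (ballot (x i) (ω.bin i k + δ i k) - ballot (x i) (ω.bin i k)) else 0 := by
      intro a
      by_cases ha : a ∈ A
      · have hne : a ≠ h := fun e => hA (e ▸ ha)
        rw [if_pos ha, if_neg hne, add_zero, show false_share a = some (sums a) from hs1 a ha]
        rfl
      · rw [if_neg ha, hs2 a ha, selectedSum_rebin x half δ ω adv hA]
    rw [Finset.sum_congr rfl fun a _ => hterm a, Finset.sum_add_distrib, Finset.sum_ite_eq',
      if_pos (mem_univ h), Finset.sum_sub_distrib]
    abel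
  have hk := hcons k
  have htk := htally k
  rw [hY] at hk htk
  refine ⟨hk, ?_⟩
  by_contra! hcon
  refine hinc (consistent_of_le ?_ ?_)
  · rw [hrev, ← htk]
    exact hk.sum_tallyOf
  · rw [hrev, ← htk]
    exact hcon

open Classical in
/-- Against a deterministic strategy, only a small fraction of the random choices lets the run
succeed with an inconsistent output. -/
theorem card_inconsistent_le (hn : 2 ≤ n) (x : Fin n → Fin r) {h : Fin t} (hA : h ∉ A)
    (adv : Strategy n r t s B A) :
    ((univ.filter fun ω : Tape n r t s =>
      ∃ out, run x adv ω = some out ∧ ¬ out.Consistent B x).card : ℝ) ≤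
      (8 / 9) ^ s * Fintype.card (Tape n r t s) := by
  refine card_le_of_orbit_card_le (Ω := Tape n r t s) (D := Fin n → Fin s → Fin n)
    (fun δ ω => rebin x h (openedHalf x adv ω) δ ω) ?_
    (fun ω => ∃ out, run x adv ω = some out ∧ ¬ out.Consistent B x) ((8 / 9) ^ s) ?_
  -- The opened half is constant on orbits, so equal images have the same half and can be moved back
  -- by `-δ`.
  · intro δ ω ω' heq
    dsimp only at heq
    have hhalf : openedHalf x adv ω = openedHalf x adv ω' := by
      rw [← openedHalf_rebin x hA (openedHalf x adv ω) δ ω adv, heq, openedHalf_rebin x hA]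
    rw [← rebin_neg_rebin x h (openedHalf x adv ω) δ ω, heq, hhalf, rebin_neg_rebin]
  · intro ω
    obtain ⟨S, E, N, hE⟩ := exists_sums_of_inconsistent x hA ω adv
    refine le_trans ?_ (card_deficit_le hn S x E N)
    norm_cast
    -- Translation by `ω.bin` turns displacements into the bins themselves.
    refine Finset.card_le_card_of_injOn (fun δ => ω.bin + δ) ?_ (add_right_injective _).injOn
    intro δ hδ
    exact Finset.mem_filter.mpr ⟨mem_univ _, hE δ (Finset.mem_filter.mp hδ).2⟩

/-- The probability of success with an inconsistent output is exponentially small. -/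
theorem result_inconsistent_le (hn : 2 ≤ n) (hA : ∃ a, a ∉ A) (x : Fin n → Fin r)
    (adv : PMF (Strategy n r t s B A)) :
    (result x adv).toOuterMeasure {o | ∃ out, o = some out ∧ ¬ out.Consistent B x} ≤
      ENNReal.ofReal ((8 / 9) ^ s) := by
  classical
  obtain ⟨h, hA⟩ := hA
  have hdet : ∀ σ : Strategy n r t s B A,
      ((PMF.uniformOfFintype (Tape n r t s)).map (run x σ)).toOuterMeasure
        {o | ∃ out, o = some out ∧ ¬ out.Consistent B x} ≤ ENNReal.ofReal ((8 / 9) ^ s) := by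
    intro σ
    rw [PMF.toOuterMeasure_map_apply, PMF.toOuterMeasure_uniformOfFintype_apply]
    have hcard := card_inconsistent_le hn x hA σ
    have hset : Fintype.card ↥(run x σ ⁻¹' {o | ∃ out, o = some out ∧ ¬ out.Consistent B x}) =
        (univ.filter fun ω : Tape n r t s =>
          ∃ out, run x σ ω = some out ∧ ¬ out.Consistent B x).card := by
      rw [Fintype.card_subtype]
      congr 1
      ext ω
      simp only [Finset.mem_filter, Finset.mem_univ, true_and]
      rfl
    rw [hset]
    have hpos : (0 : ℝ) < Fintype.card (Tape n r t s) := by exact_mod_cast Fintype.card_pos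
    rw [← ENNReal.ofReal_natCast, ← ENNReal.ofReal_natCast, ← ENNReal.ofReal_div_of_pos hpos]
    exact ENNReal.ofReal_le_ofReal ((div_le_iff₀ hpos).mpr hcard)
  rw [result, PMF.toOuterMeasure_bind_apply]
  calc _ ≤ ∑' σ, adv σ * ENNReal.ofReal ((8 / 9) ^ s) :=
        ENNReal.tsum_le_tsum fun σ => mul_le_mul_right (hdet σ) _
    _ = ENNReal.ofReal ((8 / 9) ^ s) := by
        rw [ENNReal.tsum_mul_right, PMF.tsum_coe, one_mul]

end Failure

/-! ### Ballots and equality tests of participants who follow the protocol -/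

section FollowProtocol

variable {n r t s : ℕ}

theorem simBroadcast_eq_some_of_forall {A : Finset (Fin t)} {M : Type} {f g : Fin t → M}
    {adv : Fin t → Option M} (hA : ∀ a ∈ A, adv a = some (g a)) (hf : ∀ a, a ∉ A → f a = g a) :
    simBroadcast A f adv = some g := by
  unfold simBroadcast
  rw [if_pos fun a ha => by rw [hA a ha]; rfl]
  congr 1
  funext a
  by_cases ha : a ∈ A
  · rw [if_pos ha, hA a ha, Option.getD_some]
  · rw [if_neg ha, hf a ha]

theorem simBroadcast_empty {M : Type} (f : Fin t → M) (adv : Fin t → Option M) :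
    simBroadcast ∅ f adv = some f :=
  simBroadcast_eq_some_of_forall (fun a ha => absurd ha (Finset.notMem_empty a)) fun _ _ => rfl

theorem sum_honestShare (ht : 0 < t) (ω : Tape n r t s) (c : Fin r) (i : Fin n) (k : Fin s)
    (j : Fin (2 * s)) :
    ∑ a, honestShare ω c i a k j =
      ballot (c + (ω.shift i k j).1) (ω.bin i k + (ω.shift i k j).2) :=
  makeADS_sum ht _ _

theorem sum_eqDifference {ι : Type*} (S : Finset ι) (X : ι → Fin (2 * s) → ZMod (2 * n + 1))
    (P : EqChoice s) (l : Fin s) :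
    ∑ a ∈ S, eqDifference (X a) P l = eqDifference (fun j => ∑ a ∈ S, X a j) P l := by
  simp only [eqDifference, Finset.sum_sub_distrib]
  rw [Finset.sum_comm, Finset.sum_comm (s := S) (t := (P l).1ᶜ)]

/-- Both halves of a partition have `s` elements. -/
theorem eqDifference_const (z : ZMod (2 * n + 1)) (P : EqChoice s) (l : Fin s) :
    eqDifference (fun _ => z) P l = 0 := by
  rw [eqDifference, Finset.sum_const, Finset.sum_const, Finset.card_compl, (P l).2,
    Fintype.card_fin, show 2 * s - s = s by omega, sub_self]

/-- The test finds no difference between ballots for the same candidate. -/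
theorem sum_eqDifference_eqInput_of_ballot [NeZero s] {v : Fin t → Fin s → Fin s → Bins n r}
    {c₀ : Fin r} {β : Fin s → Fin n} (hv : ∀ k j, ∑ a, v a k j = ballot c₀ (β k))
    (c : Fin r) (k : Fin s) (P : EqChoice s) (l : Fin s) :
    ∑ a, eqDifference (eqInput (v a) c k) P l = 0 := by
  have hsum : ∀ k j, ∑ a, ∑ o, v a k j c o = if c = c₀ then 1 else 0 := by
    intro k j
    rw [Finset.sum_comm, ← sum_ballot c₀ (β k) c, ← hv k j]
    simp only [Finset.sum_apply]
  rw [sum_eqDifference, ← eqDifference_const (if c = c₀ then 1 else 0) P l]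
  congr 1
  funext j
  unfold eqInput
  split_ifs <;> exact (hsum _ _).trans (by simp_all)

variable {B : Finset (Fin n)} {A : Finset (Fin t)}

theorem sum_remaining_of_honest [NeZero n] [NeZero r] (ht : 0 < t) (x : Fin n → Fin r)
    (adv : Strategy n r t s B A) (ω : Tape n r t s) (half : OpenChoice n s) {i : Fin n}
    (hi : i ∉ B) (k j : Fin s) :
    ∑ a, remaining x adv ω half i a k j = ballot (x i) (ω.bin i k) := by
  simp only [remaining, shares, if_neg hi, honestShifts]
  rw [← decrypt_sum, sum_honestShare ht, decrypt_ballot]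

theorem isBallot_sum_openedShares_of_honest (ht : 0 < t) (x : Fin n → Fin r)
    (adv : Strategy n r t s B A) (ω : Tape n r t s) (half : OpenChoice n s) {i : Fin n}
    (hi : i ∉ B) (k j : Fin s) :
    IsBallot (∑ a, openedShares x adv ω half a i k j) := by
  simp only [openedShares, shares, if_neg hi]
  exact ⟨_, _, sum_honestShare ht ω (x i) i k _⟩

theorem mem_invalidVoters {opened : Fin t → Fin n → Fin s → Fin s → Bins n r} {i : Fin n} :
    i ∈ invalidVoters opened ↔ ∃ k j, ¬ IsBallot (∑ a, opened a i k j) := by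
  simp [invalidVoters]

end FollowProtocol

theorem foldlM_option_invariant {α β : Type*} {f : β → α → Option β} (p : β → Prop)
    (hf : ∀ b a b', p b → f b a = some b' → p b') (l : List α) {b b' : β} (hb : p b)
    (h : l.foldlM f b = some b') : p b' := by
  induction l generalizing b with
  | nil =>
    cases h
    exact hb
  | cons a l ih =>
    rw [List.foldlM_cons, Option.bind_eq_bind, Option.bind_eq_some_iff] at h
    obtain ⟨b₁, h₁, h₂⟩ := h
    exact ih (hf _ _ _ hb h₁) h₂

/-! ### Honest authorities do not revoke honest votes -/

/-- Without dishonest authorities every broadcast opens the true values, so neither cause of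
revocation can occur, on any tape. -/
theorem notMem_revoked_of_honest {n r t s : ℕ} [NeZero n] [NeZero r] [NeZero s]
    {B : Finset (Fin n)} (ht : 0 < t) (x : Fin n → Fin r)
    (adv : Strategy n r t s B (∅ : Finset (Fin t))) (ω : Tape n r t s) {i : Fin n} (hi : i ∉ B)
    {out : Outcome n r} (hrun : run x adv ω = some out) : i ∉ out.revoked := by
  rw [run_eq, Option.bind_eq_some_iff] at hrun
  obtain ⟨coins, -, hrun⟩ := hrun
  rw [testStage, simBroadcast_empty, Option.bind_some, Option.bind_eq_some_iff] at hrun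
  obtain ⟨st, hst, hrun⟩ := hrun
  obtain ⟨-, -, -, -, -, -, hrev⟩ := tallyStage_eq_some hrun
  rw [hrev, Finset.mem_union, not_or]
  constructor
  · rw [mem_invalidVoters]
    rintro ⟨k, j, h⟩
    exact h (isBallot_sum_openedShares_of_honest ht x adv ω _ hi k j)
  · refine foldlM_option_invariant (fun st => i ∉ st.2) ?_ _ (Finset.notMem_empty i) hst
    intro st q st' hp hq
    simp only [eqCall, simBroadcast_empty, Option.bind_eq_bind, Option.bind_some,
      Option.pure_def, Option.some.injEq] at hq
    subst hq
    dsimp only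
    split_ifs with hz
    · exact hp
    · rw [Finset.mem_insert, not_or]
      refine ⟨?_, hp⟩
      rintro rfl
      exact hz fun l => sum_eqDifference_eqInput_of_ballot
        (sum_remaining_of_honest ht x adv ω _ hi) _ _ _ l

theorem result_revoked_eq_zero {n r t s : ℕ} [NeZero n] [NeZero r] [NeZero s]
    {B : Finset (Fin n)} (ht : 0 < t) (x : Fin n → Fin r)
    (adv : PMF (Strategy n r t s B (∅ : Finset (Fin t)))) {i : Fin n} (hi : i ∉ B) :
    (result x adv).toOuterMeasure {o | ∃ out, o = some out ∧ i ∈ out.revoked} = 0 := by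
  rw [PMF.toOuterMeasure_apply_eq_zero_iff, Set.disjoint_left]
  rintro o ho ⟨out, rfl, hout⟩
  rw [result, PMF.mem_support_bind_iff] at ho
  obtain ⟨σ, -, hσ⟩ := ho
  rw [PMF.mem_support_map_iff] at hσ
  obtain ⟨ω, -, hω⟩ := hσ
  exact notMem_revoked_of_honest ht x σ ω hi hω hout

/-! ### Dishonest authorities can revoke any votes -/

section Sums

variable {n r : ℕ} (S : Finset (Fin n)) (x : Fin n → Fin r) (β : Fin n → Fin n)

theorem val_sum_ballot (c : Fin r) (o : Fin n) :
    ((∑ i ∈ S, (ballot (x i) (β i) : Bins n r)) c o).val = binCount S x β c o := by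
  rw [sum_ballot_apply, ZMod.val_natCast_of_lt]
  have := binCount_le S x β c o
  omega

theorem tallyOf_sum_ballot (c : Fin r) :
    tallyOf (∑ i ∈ S, (ballot (x i) (β i) : Bins n r)) c = (S.filter fun i => x i = c).card := by
  simp only [tallyOf, val_sum_ballot, sum_binCount, eq_comm]

theorem sumConsistent_sum_ballot :
    SumConsistent S.card (∑ i ∈ S, (ballot (x i) (β i) : Bins n r)) := by
  refine ⟨fun c o => ?_, ?_⟩
  · rw [val_sum_ballot]
    exact binCount_le S x β c o
  · rw [Finset.card_eq_sum_card_fiberwise (f := x) (t := univ) (fun _ _ => mem_univ _)]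
    exact Finset.sum_congr rfl fun c _ => tallyOf_sum_ballot S x β c

end Sums

/-- All entries of a ballot add up to `1`, those of the sum to `2`, and `1 ≠ 0` modulo `2 * n + 1`.
-/
theorem not_isBallot_add {n r : ℕ} (hn : 0 < n) (c c' : Fin r) (o o' : Fin n) :
    ¬ IsBallot (ballot c o + ballot c' o' : Bins n r) := by
  have htotal : ∀ (c : Fin r) (o : Fin n), ∑ d, ∑ p, (ballot c o : Bins n r) d p = 1 := by
    intro c o
    simp only [sum_ballot, Finset.sum_ite_eq', mem_univ, if_true]
  rintro ⟨c'', o'', h⟩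
  have h2 : ∑ d, ∑ p, (ballot c o + ballot c' o' : Bins n r) d p = 1 := by
    rw [h, htotal]
  simp only [Pi.add_apply, Finset.sum_add_distrib, htotal] at h2
  have : Fact (1 < 2 * n + 1) := ⟨by omega⟩
  exact one_ne_zero (add_eq_left.mp h2)

/-- The messages of all authorities, if every dishonest one sends `d`. -/
def fillHonest {t : ℕ} {A : Finset (Fin t)} {M : Type} (d : M) (f : Honest A M) : Fin t → M :=
  fun a => if h : a ∈ A then d else f a h

theorem simBroadcast_const {t : ℕ} (A : Finset (Fin t)) {M : Type} (d : M) (f : Fin t → M) :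
    simBroadcast A f (fun _ => some d) = some (fillHonest d (honestPart A f)) := by
  refine simBroadcast_eq_some_of_forall (fun a ha => ?_) fun a ha => ?_
  · rw [fillHonest, dif_pos ha]
  · rw [fillHonest, dif_neg ha]
    rfl

/-- The first input to RANDOM. -/
def zeroCoin (C : Type) [Fintype C] [Nonempty C] : Coin C := ⟨0, Fintype.card_pos⟩

/-- The outcome of RANDOM if every dishonest authority inputs `0`. -/
noncomputable def filledRandom {t : ℕ} {A : Finset (Fin t)} {C : Type} [Fintype C] [Nonempty C]
    (f : Honest A (Coin C)) : C :=
  randomValue (fillHonest (zeroCoin C) f)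

/-! ### The revoking strategy -/

section Revoking

variable {n r t s : ℕ} {B : Finset (Fin n)} {A : Finset (Fin t)} [NeZero n] [NeZero r] [NeZero s]

/-- The dishonest authorities' shares, if dishonest voters submit unshifted ballots for `y` in
bin `0`, with all random values of MAKE-ADS equal to `0`. -/
def knownShares (y : Fin n → Fin r) (dealt : DealView n r t s B A) :
    Fin n → Fin t → Fin s → Fin (2 * s) → Bins n r :=
  fun i a k j => if hi : i ∈ B then makeADS (ballot (y i) 0) 0 a
    else if ha : a ∈ A then dealt i hi a ha k j else 0

/-- The dishonest authorities' decrypted shares of the remaining ballots. -/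
noncomputable def knownRemaining (y : Fin n → Fin r) (view : ShiftView n r t s B A) :
    Fin n → Fin t → Fin s → Fin s → Bins n r :=
  fun i a k j => decrypt (if hi : i ∈ B then 0 else view.shift i hi k j)
    (knownShares y view.dealt i a k ((filledRandom view.openCoin i k).outside j))

/-- The strategy that follows the protocol with the votes `y` of the dishonest voters, except that
authority `a₀` spoils the opened ballots of the voters in `R`. -/
noncomputable def revokingStrategy (y : Fin n → Fin r) (R : Finset (Fin n)) (a₀ : Fin t) :
    Strategy n r t s B A where
  deal _ i a _ _ := makeADS (ballot (y i) 0) 0 a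
  openCoin _ _ := some (zeroCoin _)
  openShare dealt coins a := some fun i k j =>
    knownShares y dealt i a k ((filledRandom coins i k).inside j) +
      if a = a₀ then if i ∈ R then ballot 0 0 else 0 else 0
  shift _ _ _ _ := 0
  eqCoin _ _ := some (zeroCoin _)
  eqShare view coins a :=
    -- Each call leaves one record, so the number of records is the position of the current call;
    -- the default is never reached in a run.
    let q := (List.finRange n ×ˢ List.finRange r ×ˢ List.finRange s).getD view.2.length (0, 0, 0)
    some (eqDifference (eqInput (knownRemaining y view.1 q.1 a) q.2.1 q.2.2) (filledRandom coins))
  bit _ _ i := decide (i ∈ R)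
  pickCoin _ _ := some (zeroCoin _)
  tallyShare view coins a := some (selectedSum (knownRemaining y view.1) R (filledRandom coins) a)
  publish view coins sums _ := tallyOf (∑ a, if ha : a ∈ A then
    selectedSum (knownRemaining y view.1) R (filledRandom coins) a 0 else sums a ha 0)

variable {x y : Fin n → Fin r} (R : Finset (Fin n)) (a₀ : Fin t)
  (ω : Tape n r t s)

/-- The collusion knows what its authorities hold: it received the honest voters' shares and fixed
those of the dishonest voters itself. -/
theorem knownShares_dealtView {a : Fin t} (ha : a ∈ A) (i : Fin n) :
    knownShares y (dealtView B A x ω) i a =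
      shares x (revokingStrategy (A := A) (B := B) y R a₀) ω i a := by
  funext k j
  by_cases hi : i ∈ B
  · simp only [knownShares, shares, dif_pos hi, if_pos hi, revokingStrategy]
  · simp only [knownShares, shares, dif_neg hi, if_neg hi, dif_pos ha, dealtView]

theorem knownRemaining_shiftView {a : Fin t} (ha : a ∈ A) (i : Fin n) :
    knownRemaining y (shiftView x (revokingStrategy (A := A) (B := B) y R a₀) ω
        (filledRandom (honestPart A ω.openCoin))) i a =
      remaining x (revokingStrategy (A := A) (B := B) y R a₀) ω
        (filledRandom (honestPart A ω.openCoin)) i a := by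
  funext k j
  simp only [knownRemaining, remaining, shiftView, knownShares_dealtView R a₀ ω ha]
  by_cases hi : i ∈ B
  · simp only [dif_pos hi, if_pos hi, revokingStrategy]
  · simp only [dif_neg hi, if_neg hi]

theorem isBallot_sum_shares_revokingStrategy (ht : 0 < t)
    (i : Fin n) (k : Fin s) (j : Fin (2 * s)) :
    IsBallot (∑ a, shares x (revokingStrategy (A := A) (B := B) y R a₀) ω i a k j) := by
  by_cases hi : i ∈ B
  · simp only [shares, if_pos hi, revokingStrategy]
    exact ⟨_, _, makeADS_sum ht _ _⟩
  · simp only [shares, if_neg hi]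
    exact ⟨_, _, sum_honestShare ht ω (x i) i k j⟩

theorem sum_remaining_revokingStrategy (hxy : ∀ i ∈ B, x i = y i) (ht : 0 < t)
    (half : OpenChoice n s) (i : Fin n) (k j : Fin s) :
    ∑ a, remaining x (revokingStrategy (A := A) (B := B) y R a₀) ω half i a k j =
      ballot (x i) (if i ∈ B then 0 else ω.bin i k) := by
  by_cases hi : i ∈ B
  · simp only [remaining, shares, if_pos hi]
    rw [← decrypt_sum]
    simp only [revokingStrategy]
    rw [makeADS_sum ht, hxy i hi]
    simpa using decrypt_ballot (0 : Fin r × Fin n) (y i) 0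
  · rw [if_neg hi, sum_remaining_of_honest ht x _ ω half hi]

theorem simBroadcast_openShare_revokingStrategy (ha₀ : a₀ ∈ A) :
    simBroadcast A (openedShares x (revokingStrategy (A := A) (B := B) y R a₀) ω
        (filledRandom (honestPart A ω.openCoin)))
      ((revokingStrategy (A := A) (B := B) y R a₀).openShare (dealtView B A x ω)
        (honestPart A ω.openCoin)) =
    some fun a i k j => openedShares x (revokingStrategy (A := A) (B := B) y R a₀) ω
        (filledRandom (honestPart A ω.openCoin)) a i k j +
      if a = a₀ then if i ∈ R then ballot 0 0 else 0 else 0 := by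
  refine simBroadcast_eq_some_of_forall (fun a ha => ?_) fun a ha => ?_
  · simp only [revokingStrategy, Option.some.injEq]
    funext i k j
    rw [knownShares_dealtView R a₀ ω ha]
    rfl
  · funext i k j
    rw [if_neg (ne_of_mem_of_not_mem ha₀ ha).symm, add_zero]

theorem invalidVoters_revokingStrategy (ht : 0 < t) :
    invalidVoters (fun a i k j =>
      openedShares x (revokingStrategy (A := A) (B := B) y R a₀) ω
        (filledRandom (honestPart A ω.openCoin)) a i k j +
      if a = a₀ then if i ∈ R then ballot 0 0 else 0 else 0) = R := by
  have hn : 0 < n := Nat.pos_of_ne_zero (NeZero.ne n)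
  ext i
  rw [mem_invalidVoters]
  have hsum := isBallot_sum_shares_revokingStrategy (A := A) (B := B) (x := x) (y := y) R a₀ ω ht i
  simp only [Finset.sum_add_distrib, Finset.sum_ite_eq', mem_univ, if_true, openedShares]
  by_cases hi : i ∈ R
  · simp only [hi, if_true, iff_true]
    obtain ⟨c, o, hco⟩ := hsum 0 ((filledRandom (honestPart A ω.openCoin) i 0).inside 0)
    exact ⟨0, 0, by rw [hco]; exact not_isBallot_add hn _ _ _ _⟩
  · simp only [hi, if_false, add_zero, iff_false, not_exists, not_not]
    exact fun k j => hsum _ _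

/-- Only opened ballots are spoiled. The remaining ones of each voter are for one candidate, also
for voters in `R`, so the tests add a record but no voter. -/
theorem eqCall_revokingStrategy (hxy : ∀ i ∈ B, x i = y i) (ht : 0 < t)
    (st : List (EqRecord n t s A) × Finset (Fin n))
    (q : Fin n × Fin r × Fin s)
    (hq : (List.finRange n ×ˢ List.finRange r ×ˢ List.finRange s).getD st.1.length (0, 0, 0) = q) :
    ∃ e, eqCall (revokingStrategy (A := A) (B := B) y R a₀) ω
        (shiftView x (revokingStrategy (A := A) (B := B) y R a₀) ω
          (filledRandom (honestPart A ω.openCoin)))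
        (remaining x (revokingStrategy (A := A) (B := B) y R a₀) ω
          (filledRandom (honestPart A ω.openCoin))) st q =
      some (e :: st.1, st.2) := by
  set σ := revokingStrategy (s := s) (A := A) (B := B) y R a₀ with hσ
  set half := filledRandom (honestPart A ω.openCoin) with hhalf
  have hcoin : simBroadcast A (ω.eqCoin q.1 q.2.1 q.2.2)
      (σ.eqCoin (shiftView x σ ω half, st.1)) =
      some (fillHonest (zeroCoin _) (honestPart A (ω.eqCoin q.1 q.2.1 q.2.2))) :=
    simBroadcast_const _ _ _
  have hrandom : randomValue (fillHonest (zeroCoin _) (honestPart A (ω.eqCoin q.1 q.2.1 q.2.2))) =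
      filledRandom (honestPart A (ω.eqCoin q.1 q.2.1 q.2.2)) := rfl
  let f : Fin t → Fin s → ZMod (2 * n + 1) := fun a =>
    eqDifference (eqInput (remaining x σ ω half q.1 a) q.2.1 q.2.2)
      (filledRandom (honestPart A (ω.eqCoin q.1 q.2.1 q.2.2)))
  have hshare : simBroadcast A f (σ.eqShare (shiftView x σ ω half, st.1)
      (honestPart A (ω.eqCoin q.1 q.2.1 q.2.2))) = some f := by
    refine simBroadcast_eq_some_of_forall (fun a ha => ?_) fun _ _ => rfl
    have hdef : σ.eqShare (shiftView x σ ω half, st.1)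
        (honestPart A (ω.eqCoin q.1 q.2.1 q.2.2)) a =
        some (eqDifference (eqInput (knownRemaining y (shiftView x σ ω half) q.1 a) q.2.1 q.2.2)
          (filledRandom (honestPart A (ω.eqCoin q.1 q.2.1 q.2.2)))) := by
      rw [← hq]
      rfl
    rw [hdef, knownRemaining_shiftView R a₀ ω ha]
  refine ⟨⟨honestPart A (ω.eqCoin q.1 q.2.1 q.2.2), honestPart A f⟩, ?_⟩
  simp only [eqCall, hcoin, hrandom, Option.bind_eq_bind, Option.bind_some]
  rw [hshare, Option.bind_some, if_pos]
  · rfl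
  · exact fun l => sum_eqDifference_eqInput_of_ballot
      (sum_remaining_revokingStrategy R a₀ ω hxy ht half q.1) _ _ _ l

end Revoking

/-- A fold whose steps add one record each. -/
theorem foldlM_option_exists {α β γ : Type*} (d : α)
    {f : List β × γ → α → Option (List β × γ)} (l : List α)
    (hf : ∀ st a, l.getD st.1.length d = a → ∃ b, f st a = some (b :: st.1, st.2))
    (c : γ) : ∃ bs, l.foldlM f ([], c) = some (bs, c) := by
  -- The induction carries the processed prefix `l₁`, whose length locates the next element in the
  -- whole list `l`.
  have key : ∀ (l₂ l₁ : List α) (bs : List β), l = l₁ ++ l₂ → bs.length = l₁.length →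
      ∃ bs', l₂.foldlM f (bs, c) = some (bs', c) := by
    intro l₂
    induction l₂ with
    | nil => exact fun l₁ bs _ _ => ⟨bs, rfl⟩
    | cons a l₂ ih =>
      intro l₁ bs hl hbs
      obtain ⟨b, hb⟩ := hf (bs, c) a (by simp [hl, hbs])
      obtain ⟨bs', h⟩ := ih (l₁ ++ [a]) (b :: bs) (by simp [hl]) (by simp [hbs])
      exact ⟨bs', by rw [List.foldlM_cons, hb]; exact h⟩
  exact key l [] [] rfl rfl

section Revoking

variable {n r t s : ℕ} {B : Finset (Fin n)} {A : Finset (Fin t)} [NeZero n] [NeZero r] [NeZero s]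
  {x y : Fin n → Fin r} (R : Finset (Fin n)) (a₀ : Fin t) (ω : Tape n r t s)

/-- All shares are correct, so the sums are those of genuine ballots; their tallies do not depend on
the bins and hence agree for all `k`. -/
theorem tallyStage_revokingStrategy (hxy : ∀ i ∈ B, x i = y i) (ht : 0 < t)
    (records : List (EqRecord n t s A)) :
    tallyStage (revokingStrategy (A := A) (B := B) y R a₀) ω
        (shiftView x (revokingStrategy (A := A) (B := B) y R a₀) ω
          (filledRandom (honestPart A ω.openCoin)))
        (remaining x (revokingStrategy (A := A) (B := B) y R a₀) ω
          (filledRandom (honestPart A ω.openCoin)))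
        records R = some ⟨countVotes x R, R⟩ := by
  set σ := revokingStrategy (s := s) (A := A) (B := B) y R a₀ with hσ
  set half := filledRandom (honestPart A ω.openCoin) with hhalf
  set pick := filledRandom (honestPart A ω.pickCoin) with hpick
  have hsel : ∀ a ∈ A, selectedSum (knownRemaining y (shiftView x σ ω half)) R pick a =
      selectedSum (remaining x σ ω half) R pick a := by
    intro a ha
    funext k
    simp only [selectedSum, hσ, hhalf, knownRemaining_shiftView R a₀ ω ha]
  have hcoins : simBroadcast A ω.pickCoin (σ.pickCoin (shiftView x σ ω half, records)) =
      some (fillHonest (zeroCoin _) (honestPart A ω.pickCoin)) := simBroadcast_const _ _ _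
  have hsums : simBroadcast A (selectedSum (remaining x σ ω half) R pick)
      (σ.tallyShare (shiftView x σ ω half, records) (honestPart A ω.pickCoin)) =
      some (selectedSum (remaining x σ ω half) R pick) := by
    refine simBroadcast_eq_some_of_forall (fun a ha => ?_) fun _ _ => rfl
    rw [← hsel a ha]
    rfl
  have hY : ∀ k, ∑ a, selectedSum (remaining x σ ω half) R pick a k =
      ∑ i ∈ Rᶜ, ballot (x i) (if i ∈ B then 0 else ω.bin i k) := by
    intro k
    simp only [selectedSum]
    rw [Finset.sum_comm]
    exact Finset.sum_congr rfl fun i _ =>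
      sum_remaining_revokingStrategy R a₀ ω hxy ht half i k _
  have htally : ∀ k, tallyOf (∑ a, selectedSum (remaining x σ ω half) R pick a k) =
      countVotes x R := by
    intro k
    funext c
    rw [hY, tallyOf_sum_ballot, countVotes]
  have hpub : ∀ a, σ.publish (shiftView x σ ω half, records) (honestPart A ω.pickCoin)
      (honestPart A (selectedSum (remaining x σ ω half) R pick)) a = countVotes x R := by
    intro a
    rw [← htally 0]
    change tallyOf _ = _
    congr 1
    refine Finset.sum_congr rfl fun a _ => ?_
    split_ifs with ha
    · exact congrFun (hsel a ha) 0
    · rfl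
  simp only [tallyStage, Option.bind_eq_bind, Option.bind_eq_some_iff, Option.guard_eq_some',
    Option.pure_def, Option.some.injEq]
  refine ⟨(), fun a _ i => decide_eq_true_iff, _, hcoins, _, hsums, (), fun k => ?_, (),
    fun k => (htally k).trans (htally 0).symm, (), fun a _ => (hpub a).trans (htally 0).symm, ?_⟩
  · rw [hY]
    exact sumConsistent_sum_ballot _ _ _
  · rw [htally 0]

theorem run_revokingStrategy (hxy : ∀ i ∈ B, x i = y i) (ha₀ : a₀ ∈ A) :
    run x (revokingStrategy (A := A) (B := B) y R a₀) ω = some ⟨countVotes x R, R⟩ := by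
  have ht : 0 < t := Fin.pos a₀
  obtain ⟨records, hrec⟩ := foldlM_option_exists (0, 0, 0)
    (List.finRange n ×ˢ List.finRange r ×ˢ List.finRange s)
    (fun st q hq => eqCall_revokingStrategy R a₀ ω hxy ht st q hq) ∅
  have hcoins : simBroadcast A ω.openCoin
      ((revokingStrategy (A := A) (B := B) y R a₀).openCoin (dealtView B A x ω)) =
      some (fillHonest (zeroCoin _) (honestPart A ω.openCoin)) := simBroadcast_const _ _ _
  rw [run_eq, hcoins, Option.bind_some]
  change testStage x _ ω (filledRandom (honestPart A ω.openCoin)) = _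
  rw [testStage, simBroadcast_openShare_revokingStrategy R a₀ ω ha₀, Option.bind_some, hrec,
    Option.bind_some, invalidVoters_revokingStrategy R a₀ ω ht, Finset.union_empty,
    tallyStage_revokingStrategy R a₀ ω hxy ht]

theorem result_revokingStrategy (hxy : ∀ i ∈ B, x i = y i) (ha₀ : a₀ ∈ A) :
    result x (PMF.pure (revokingStrategy (A := A) (B := B) (s := s) y R a₀))
      (some ⟨countVotes x R, R⟩) = 1 := by
  have hconst : run x (revokingStrategy (A := A) (B := B) (s := s) y R a₀) =
      Function.const _ (some ⟨countVotes x R, R⟩) :=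
    funext fun ω => run_revokingStrategy R a₀ ω hxy ha₀
  rw [result, PMF.pure_bind, hconst, PMF.map_const, PMF.pure_apply_self]

end Revoking

end RobustVote

theorem theorem6 :
    -- The probability of success with an inconsistent output is exponentially small.
    (∃ q : ℝ, 0 < q ∧ q < 1 ∧
      ∀ (n r t s : ℕ) [NeZero n] [NeZero r] [NeZero s], 2 ≤ n →
      ∀ (B : Finset (Fin n)) (A : Finset (Fin t)), (∃ a, a ∉ A) →
      ∀ (x : Fin n → Fin r) (adv : PMF (RobustVote.Strategy n r t s B A)),
        (RobustVote.result x adv).toOuterMeasure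
            {o | ∃ out, o = some out ∧ ¬ out.Consistent B x} ≤
          ENNReal.ofReal (q ^ s)) ∧
    -- Any dishonest authorities can revoke any votes, and let the protocol succeed otherwise.
    (∀ (n r t s : ℕ) [NeZero n] [NeZero r] [NeZero s]
      (B : Finset (Fin n)) (A : Finset (Fin t)), A.Nonempty → (∃ a, a ∉ A) →
      ∀ (R : Finset (Fin n)) (y : Fin n → Fin r),
      ∃ adv : PMF (RobustVote.Strategy n r t s B A),
        ∀ x : Fin n → Fin r, (∀ i ∈ B, x i = y i) →
          RobustVote.result x adv (some ⟨RobustVote.countVotes x R, R⟩) = 1) ∧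
    -- If all authorities are honest, then no vote of an honest voter is revoked.
    (∀ (n r t s : ℕ) [NeZero n] [NeZero r] [NeZero s] (B : Finset (Fin n)), 0 < t →
      ∀ (x : Fin n → Fin r) (adv : PMF (RobustVote.Strategy n r t s B (∅ : Finset (Fin t)))),
      ∀ i, i ∉ B →
        (RobustVote.result x adv).toOuterMeasure {o | ∃ out, o = some out ∧ i ∈ out.revoked} =
          0) := by
  refine ⟨⟨8 / 9, by norm_num, by norm_num, ?_⟩, ?_, ?_⟩
  · intro n r t s _ _ _ hn B A hA x adv
    exact RobustVote.result_inconsistent_le hn hA x adv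
  · intro n r t s _ _ _ B A hA _ R y
    obtain ⟨a₀, ha₀⟩ := hA
    exact ⟨PMF.pure (RobustVote.revokingStrategy y R a₀),
      fun x hxy => RobustVote.result_revokingStrategy R a₀ hxy ha₀⟩
  · intro n r t s _ _ _ B ht x adv i hi
    exact RobustVote.result_revoked_eq_zero ht x adv hi
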